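/- Let $r\ge 1$ and $n\ge 2$ be integers, let $\zeta=e^{2\pi i/r}$, let $A=(\zeta^{j(i-1)})_{1\le i,j\le r}$, $\Delta=\det A$, and let $B=(b_{ij})$ be the adjugate of $A$, so that $A^{-1}=\Delta^{-1}B$. Put $F_c(X)=\sum_{j=1}^r b_{cj}X^{j-1}$ for $1\le c\le r$. Let $q$ be an indeterminate and $R=\mathbb{Z}[\tfrac1r][q,q^{-1},\zeta,\Delta^{-1}]$. All algebras are associative unital $R$-algebras. The affine Yokonuma–Hecke algebra $\widehat Y_{r,n}$ is generated by $t_1,\dots,t_n$, $g_1,\dots,g_{n-1}$, $X_1^{\pm1}$ with the relations: $g_ig_j=g_jg_i$ for $|i-j|\ge2$; $g_ig_{i+1}g_i=g_{i+1}g_ig_{i+1}$ for $1\le i\le n-2$; $t_it_j=t_jt_i$; $g_it_j=t_{s_i(j)}g_i$ with $s_i=(i,i+1)$; $t_i^r=1$; $g_i^2=1+(q-q^{-1})e_ig_i$ with $e_i=\frac1r\sum_{s=0}^{r-1}t_i^st_{i+1}^{-s}$; $X_1X_1^{-1}=X_1^{-1}X_1=1$; $g_1X_1g_1X_1=X_1g_1X_1g_1$;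 $g_iX_1=X_1g_i$ for $2\le i\le n-1$; $t_jX_1=X_1t_j$. The algebra $\widehat{\mathcal C}^{\mathrm{aff}}_{r,n}$ is generated by $w_1,\dots,w_n$, $h_{s_0},\dots,h_{s_{n-1}}$, $h_\rho^{\pm1}$ with the following relations, where $w_0=w_n$ and the indices of $h_{s_i}$ are read modulo $n$: (1) $w_i^r=1$, $w_iw_j=w_jw_i$, and $h_\rho w_j=w_{j-1}h_\rho$ for $1\le i,j\le n$; (2) $h_\rho h_\rho^{-1}=h_\rho^{-1}h_\rho=1$; $h_\rho h_{s_i}=h_{s_{i-1}}h_\rho$ for all $i$; $h_{s_i}h_{s_j}=h_{s_j}h_{s_i}$ if $i-j\not\equiv\pm1\pmod n$; $h_{s_i}h_{s_{i+1}}h_{s_i}=h_{s_{i+1}}h_{s_i}h_{s_{i+1}}$ for all $i$ if $n\ge3$; $h_{s_i}^2=1+(q-q^{-1})h_{s_i}$ for all $i$; (3) for $1\le i\le n-1$: $h_{s_i}w_i=w_{i+1}h_{s_i}-D_i$, $h_{s_i}w_{i+1}=w_ih_{s_i}+D_i$, and $h_{s_i}w_l=w_lh_{s_i}$ for $1\le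 l\le n$, $l\ne i,i+1$, where $D_i=\Delta^{-2}\sum_{1\le c_1<c_2\le r}(\zeta^{c_2}-\zeta^{c_1})(q-q^{-1})F_{c_1}(w_i)F_{c_2}(w_{i+1})$. Let $\widehat{\mathcal H}^{\mathrm{aff}}_n$ be the $R$-subalgebra of $\widehat{\mathcal C}^{\mathrm{aff}}_{r,n}$ generated by $h_{s_0},\dots,h_{s_{n-1}}$ and $h_\rho^{\pm1}$. Then $\widehat{\mathcal H}^{\mathrm{aff}}_n$ is the extended affine Hecke algebra of type $A$ over $R$: the natural map to it from the $R$-algebra presented by generators $h_{s_0},\dots,h_{s_{n-1}},h_\rho^{\pm1}$ and the relations (2) is an isomorphism. Moreover $\widehat{\mathcal H}^{\mathrm{aff}}_n$ is a subalgebra of $\widehat Y_{r,n}$: there is an injective $R$-algebra homomorphism $\iota:\widehat{\mathcal H}^{\mathrm{aff}}_n\to\widehat Y_{r,n}$ with $\iota(h_\rho)=g_{n-1}\cdots g_1X_1$ and $$\iota(h_{s_i})=g_i+\Delta^{-2}(q-q^{-1})\sum_{1\le c_1<c_2\le r}F_{c_1}(t_i)F_{c_2}(t_{i+1})\qquad(1\le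 i\le n-1).$$ -/

import Mathlib

/-! Indices `1, …, n` are read modulo `n`, in `ZMod n`, so that `t_0 = t_n` and `w_0 = w_n`;
the index `0` of `s_0` is `0 : ZMod n`. -/

namespace AffYH

noncomputable section

/-! ### The coefficient ring `R = ℤ[1/r][q, q⁻¹, ζ, Δ⁻¹]` -/

/-- The root of unity `ζ = e^{2πi/r}`. -/
def zetaC (r : ℕ) : ℂ := Complex.exp (2 * Real.pi * Complex.I / r)

/-- The Vandermonde determinant `Δ` of `(ζ^{j(i-1)})_{1 ≤ i, j ≤ r}`; `Fin r` starts at `0`, so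
`i : Fin r` stands for the index `i + 1`. -/
def deltaC (r : ℕ) : ℂ :=
  (Matrix.of fun i j : Fin r => zetaC r ^ ((j.val + 1) * i.val)).det

/-- `ℤ[1/r, ζ, Δ⁻¹]`, as a subring of `ℂ`. -/
abbrev Base (r : ℕ) : Subalgebra ℤ ℂ :=
  Algebra.adjoin ℤ {((r : ℂ))⁻¹, zetaC r, (deltaC r)⁻¹}

/-- `R = ℤ[1/r][q, q⁻¹, ζ, Δ⁻¹]`: Laurent polynomials in the indeterminate `q`. -/
abbrev Coeff (r : ℕ) : Type := LaurentPolynomial (Base r)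

def rInv (r : ℕ) : Base r := ⟨((r : ℂ))⁻¹, Algebra.subset_adjoin (by simp)⟩

def zeta (r : ℕ) : Base r := ⟨zetaC r, Algebra.subset_adjoin (by simp)⟩

def deltaInv (r : ℕ) : Base r := ⟨(deltaC r)⁻¹, Algebra.subset_adjoin (by simp)⟩

/-- The scalar `q - q⁻¹`. -/
def qq (r : ℕ) : Coeff r := LaurentPolynomial.T 1 - LaurentPolynomial.T (-1)

/-- The Vandermonde matrix `A = (ζ^{j(i-1)})`, over the coefficient ring. -/
def vand (r : ℕ) : Matrix (Fin r) (Fin r) (Base r) :=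
  Matrix.of fun i j => zeta r ^ ((j.val + 1) * i.val)

/-- `F_c(X) = ∑_j b_{cj} X^{j-1}`, where `B = (b_{ij})` is the adjugate of `A`. -/
def F (r : ℕ) (c : Fin r) : Polynomial (Coeff r) :=
  ∑ j : Fin r, Polynomial.monomial j.val (LaurentPolynomial.C ((vand r).adjugate c j))

variable {A : Type*} [Semiring A]

/-- `(1/r) ∑_{s=0}^{r-1} x^s y^{-s}`. It is only used where `y^r = 1` holds, so `y^{-s}` is written
`y^{r-s}`. -/
def idem (r : ℕ) [Algebra (Coeff r) A] (x y : A) : A :=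
  (LaurentPolynomial.C (rInv r) : Coeff r) • ∑ s ∈ Finset.range r, x ^ s * y ^ (r - s)

/-- `Δ^{-2} (q - q⁻¹) ∑_{c₁ < c₂} F_{c₁}(x) F_{c₂}(y)`. -/
def corr (r : ℕ) [Algebra (Coeff r) A] (x y : A) : A :=
  (LaurentPolynomial.C (deltaInv r ^ 2) * qq r : Coeff r) •
    ∑ c₁ : Fin r, ∑ c₂ ∈ Finset.Ioi c₁,
      Polynomial.aeval x (F r c₁) * Polynomial.aeval y (F r c₂)

/-- `Δ^{-2} ∑_{c₁ < c₂} (ζ^{c₂} - ζ^{c₁}) (q - q⁻¹) F_{c₁}(x) F_{c₂}(y)`. -/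
def twist (r : ℕ) [Algebra (Coeff r) A] (x y : A) : A :=
  (LaurentPolynomial.C (deltaInv r ^ 2) : Coeff r) •
    ∑ c₁ : Fin r, ∑ c₂ ∈ Finset.Ioi c₁,
      (LaurentPolynomial.C (zeta r ^ (c₂.val + 1) - zeta r ^ (c₁.val + 1)) * qq r : Coeff r) •
        (Polynomial.aeval x (F r c₁) * Polynomial.aeval y (F r c₂))

/-! ### The affine Yokonuma–Hecke algebra -/

/-- Generators: `t_j` for `1 ≤ j ≤ n`, `g_1, …, g_{n-1}` (with `g i` standing for `g_{i+1}`), and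
`X_1`, `X_1⁻¹`. -/
inductive YGen (n : ℕ) : Type
  | t (j : ZMod n)
  | g (i : Fin (n - 1))
  | X
  | Xinv

/-- The index in `{1, …, n-1}` of the generator `g i`, modulo `n`. -/
def pos {n : ℕ} (i : Fin (n - 1)) : ZMod n := ((i.val + 1 : ℕ) : ZMod n)

abbrev YFree (r n : ℕ) : Type := FreeAlgebra (Coeff r) (YGen n)

inductive YRel (r n : ℕ) : YFree r n → YFree r n → Prop
  | g_comm (i j : Fin (n - 1)) (h : i.val + 2 ≤ j.val ∨ j.val + 2 ≤ i.val) :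
      YRel r n (FreeAlgebra.ι _ (.g i) * FreeAlgebra.ι _ (.g j))
        (FreeAlgebra.ι _ (.g j) * FreeAlgebra.ι _ (.g i))
  | g_braid (i j : Fin (n - 1)) (h : j.val = i.val + 1) :
      YRel r n (FreeAlgebra.ι _ (.g i) * FreeAlgebra.ι _ (.g j) * FreeAlgebra.ι _ (.g i))
        (FreeAlgebra.ι _ (.g j) * FreeAlgebra.ι _ (.g i) * FreeAlgebra.ι _ (.g j))
  | t_comm (i j : ZMod n) :
      YRel r n (FreeAlgebra.ι _ (.t i) * FreeAlgebra.ι _ (.t j))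
        (FreeAlgebra.ι _ (.t j) * FreeAlgebra.ι _ (.t i))
  | g_t (i : Fin (n - 1)) (j : ZMod n) :
      YRel r n (FreeAlgebra.ι _ (.g i) * FreeAlgebra.ι _ (.t j))
        (FreeAlgebra.ι _ (.t (Equiv.swap (pos i) (pos i + 1) j)) * FreeAlgebra.ι _ (.g i))
  | t_pow (i : ZMod n) : YRel r n (FreeAlgebra.ι _ (.t i) ^ r) 1
  | g_sq (i : Fin (n - 1)) :
      YRel r n (FreeAlgebra.ι _ (.g i) ^ 2)
        (1 + qq r • (idem r (FreeAlgebra.ι _ (.t (pos i))) (FreeAlgebra.ι _ (.t (pos i + 1))) *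
          FreeAlgebra.ι _ (.g i)))
  | X_Xinv : YRel r n (FreeAlgebra.ι _ .X * FreeAlgebra.ι _ .Xinv) 1
  | Xinv_X : YRel r n (FreeAlgebra.ι _ .Xinv * FreeAlgebra.ι _ .X) 1
  | g_X_one (i : Fin (n - 1)) (h : i.val = 0) :
      YRel r n
        (FreeAlgebra.ι _ (.g i) * FreeAlgebra.ι _ .X * FreeAlgebra.ι _ (.g i) *
          FreeAlgebra.ι _ .X)
        (FreeAlgebra.ι _ .X * FreeAlgebra.ι _ (.g i) * FreeAlgebra.ι _ .X *
          FreeAlgebra.ι _ (.g i))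
  | g_X (i : Fin (n - 1)) (h : 1 ≤ i.val) :
      YRel r n (FreeAlgebra.ι _ (.g i) * FreeAlgebra.ι _ .X)
        (FreeAlgebra.ι _ .X * FreeAlgebra.ι _ (.g i))
  | t_X (j : ZMod n) :
      YRel r n (FreeAlgebra.ι _ (.t j) * FreeAlgebra.ι _ .X)
        (FreeAlgebra.ι _ .X * FreeAlgebra.ι _ (.t j))

/-- The affine Yokonuma–Hecke algebra `Ŷ_{r,n}` over `R`. -/
abbrev Y (r n : ℕ) : Type := RingQuot (YRel r n)

def Y.of (r n : ℕ) (x : YGen n) : Y r n :=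
  RingQuot.mkAlgHom (Coeff r) (YRel r n) (FreeAlgebra.ι _ x)

/-! ### The algebra `Ĉ^aff_{r,n}` -/

/-- Generators: `w_1, …, w_n`, `h_{s_0}, …, h_{s_{n-1}}`, `h_ρ`, `h_ρ⁻¹`. -/
inductive CGen (n : ℕ) : Type
  | w (j : ZMod n)
  | s (i : ZMod n)
  | rho
  | rhoInv

abbrev CFree (r n : ℕ) : Type := FreeAlgebra (Coeff r) (CGen n)

inductive CRel (r n : ℕ) : CFree r n → CFree r n → Prop
  | w_pow (i : ZMod n) : CRel r n (FreeAlgebra.ι _ (.w i) ^ r) 1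
  | w_comm (i j : ZMod n) :
      CRel r n (FreeAlgebra.ι _ (.w i) * FreeAlgebra.ι _ (.w j))
        (FreeAlgebra.ι _ (.w j) * FreeAlgebra.ι _ (.w i))
  | rho_w (j : ZMod n) :
      CRel r n (FreeAlgebra.ι _ .rho * FreeAlgebra.ι _ (.w j))
        (FreeAlgebra.ι _ (.w (j - 1)) * FreeAlgebra.ι _ .rho)
  | rho_s (i : ZMod n) :
      CRel r n (FreeAlgebra.ι _ .rho * FreeAlgebra.ι _ (.s i))
        (FreeAlgebra.ι _ (.s (i - 1)) * FreeAlgebra.ι _ .rho)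
  | s_comm (i j : ZMod n) (h : i - j ≠ 1) (h' : i - j ≠ -1) :
      CRel r n (FreeAlgebra.ι _ (.s i) * FreeAlgebra.ι _ (.s j))
        (FreeAlgebra.ι _ (.s j) * FreeAlgebra.ι _ (.s i))
  | s_braid (hn : 3 ≤ n) (i : ZMod n) :
      CRel r n
        (FreeAlgebra.ι _ (.s i) * FreeAlgebra.ι _ (.s (i + 1)) * FreeAlgebra.ι _ (.s i))
        (FreeAlgebra.ι _ (.s (i + 1)) * FreeAlgebra.ι _ (.s i) * FreeAlgebra.ι _ (.s (i + 1)))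
  | s_sq (i : ZMod n) :
      CRel r n (FreeAlgebra.ι _ (.s i) ^ 2) (1 + qq r • FreeAlgebra.ι _ (.s i))
  | s_w (i : ZMod n) (hi : i ≠ 0) :
      CRel r n (FreeAlgebra.ι _ (.s i) * FreeAlgebra.ι _ (.w i))
        (FreeAlgebra.ι _ (.w (i + 1)) * FreeAlgebra.ι _ (.s i) -
          twist r (FreeAlgebra.ι _ (.w i)) (FreeAlgebra.ι _ (.w (i + 1))))
  | s_w_succ (i : ZMod n) (hi : i ≠ 0) :
      CRel r n (FreeAlgebra.ι _ (.s i) * FreeAlgebra.ι _ (.w (i + 1)))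
        (FreeAlgebra.ι _ (.w i) * FreeAlgebra.ι _ (.s i) +
          twist r (FreeAlgebra.ι _ (.w i)) (FreeAlgebra.ι _ (.w (i + 1))))
  | s_w_comm (i l : ZMod n) (hi : i ≠ 0) (h : l ≠ i) (h' : l ≠ i + 1) :
      CRel r n (FreeAlgebra.ι _ (.s i) * FreeAlgebra.ι _ (.w l))
        (FreeAlgebra.ι _ (.w l) * FreeAlgebra.ι _ (.s i))
  | rho_rhoInv : CRel r n (FreeAlgebra.ι _ .rho * FreeAlgebra.ι _ .rhoInv) 1
  | rhoInv_rho : CRel r n (FreeAlgebra.ι _ .rhoInv * FreeAlgebra.ι _ .rho) 1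

/-- The algebra `Ĉ^aff_{r,n}` over `R`. -/
abbrev C (r n : ℕ) : Type := RingQuot (CRel r n)

def C.of (r n : ℕ) (x : CGen n) : C r n :=
  RingQuot.mkAlgHom (Coeff r) (CRel r n) (FreeAlgebra.ι _ x)

/-- The `R`-subalgebra of `Ĉ^aff_{r,n}` generated by `h_{s_0}, …, h_{s_{n-1}}` and `h_ρ^{±1}`. -/
def heckeSub (r n : ℕ) : Subalgebra (Coeff r) (C r n) :=
  Algebra.adjoin (Coeff r)
    (Set.range (fun i : ZMod n => C.of r n (.s i)) ∪ {C.of r n .rho, C.of r n .rhoInv})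

/-! ### The extended affine Hecke algebra of type `A` -/

/-- Generators: `T_{s_0}, …, T_{s_{n-1}}`, `T_ρ`, `T_ρ⁻¹`. -/
inductive HGen (n : ℕ) : Type
  | s (i : ZMod n)
  | rho
  | rhoInv

abbrev HFree (r n : ℕ) : Type := FreeAlgebra (Coeff r) (HGen n)

inductive HRel (r n : ℕ) : HFree r n → HFree r n → Prop
  | rho_s (i : ZMod n) :
      HRel r n (FreeAlgebra.ι _ .rho * FreeAlgebra.ι _ (.s i))
        (FreeAlgebra.ι _ (.s (i - 1)) * FreeAlgebra.ι _ .rho)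
  | s_comm (i j : ZMod n) (h : i - j ≠ 1) (h' : i - j ≠ -1) :
      HRel r n (FreeAlgebra.ι _ (.s i) * FreeAlgebra.ι _ (.s j))
        (FreeAlgebra.ι _ (.s j) * FreeAlgebra.ι _ (.s i))
  | s_braid (hn : 3 ≤ n) (i : ZMod n) :
      HRel r n
        (FreeAlgebra.ι _ (.s i) * FreeAlgebra.ι _ (.s (i + 1)) * FreeAlgebra.ι _ (.s i))
        (FreeAlgebra.ι _ (.s (i + 1)) * FreeAlgebra.ι _ (.s i) * FreeAlgebra.ι _ (.s (i + 1)))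
  | s_sq (i : ZMod n) :
      HRel r n (FreeAlgebra.ι _ (.s i) ^ 2) (1 + qq r • FreeAlgebra.ι _ (.s i))
  | rho_rhoInv : HRel r n (FreeAlgebra.ι _ .rho * FreeAlgebra.ι _ .rhoInv) 1
  | rhoInv_rho : HRel r n (FreeAlgebra.ι _ .rhoInv * FreeAlgebra.ι _ .rho) 1

/-- The extended affine Hecke algebra of type `A` over `R` (Iwahori–Matsumoto presentation). -/
abbrev H (r n : ℕ) : Type := RingQuot (HRel r n)

def H.of (r n : ℕ) (x : HGen n) : H r n :=
  RingQuot.mkAlgHom (Coeff r) (HRel r n) (FreeAlgebra.ι _ x)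

/-- The product `g_{n-1} ⋯ g_1` in `Ŷ_{r,n}`. -/
def gProd (r n : ℕ) : Y r n :=
  ((List.finRange (n - 1)).map fun i => Y.of r n (.g i)).reverse.prod

end

end AffYH

namespace AffYH

noncomputable section

/-! ### Scalars -/

/-! If `x ^ r = 1`, then `E_c(x) = Δ⁻¹ F_c(x)` is the projection on the `ζ^c`-eigenspace of `x`.
Hence `e_i` is the sum of the `E_c(t_i) E_c(t_{i+1})`, the correction term is `κ L(t_i, t_{i+1})`
with `κ = q - q⁻¹` and `L(x, y) = ∑_{c < d} E_c(x) E_d(y)`, and `D_i = (w_{i+1} - w_i) κ L(w_i,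
w_{i+1})`. For commuting `x, y`, identities between such elements are statements about the order of
the eigenvalue indices.

In this way `h_i = g_i + κ L(t_i, t_{i+1})` satisfies the Hecke quadratic relation
(`EigenData.quadratic`, from `L(x, y) + e + L(y, x) = 1`) and the braid relation
(`EigenData.braid`). The element `ρ = g_{n-1} ⋯ g_1 X_1` shifts the indices of the `t_j` and of the
`h_i`, and `ρ²` carries `h_1` to `h_{n-1}` by the relation between `g_1` and `X_1`. So `h_0 = ρ h_1
ρ⁻¹` completes a cyclic family, whose relations are all conjugates of relations among `h_1, …,
h_{n-1}`. This gives `φ : Ĉ → Ŷ` with `w_j ↦ t_j` (`YokonumaSystem.exists_heckeSystem`).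

Conversely, sending every `t_j` to `1` turns the relations of `Ŷ` into those of the Hecke algebra,
with `X_1 = (s_{n-1} ⋯ s_1)⁻¹ ρ` (`HeckeSystem.exists_yokonumaSystem`); this gives `π : Ŷ → H`.
Since `L(1, 1) = 0`, the composite `H → Ĉ → Ŷ → H` fixes the generators. So `H → Ĉ` is injective
with image the subalgebra, and `φ` is injective on that image. No basis theorem is needed. -/

theorem isPrimitiveRoot_zeta {r : ℕ} (hr : 1 ≤ r) : IsPrimitiveRoot (zeta r) r := by
  have h : IsPrimitiveRoot (zetaC r) r := Complex.isPrimitiveRoot_exp r (by omega)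
  exact IsPrimitiveRoot.of_map_of_injective (f := (Base r).val) h Subtype.val_injective

/-- The matrix is the transposed Vandermonde matrix of the nodes `ζ, ζ², …, ζ^r`, which are distinct
because `ζ` is primitive. -/
theorem deltaC_ne_zero {r : ℕ} (hr : 1 ≤ r) : deltaC r ≠ 0 := by
  have h : IsPrimitiveRoot (zetaC r) r := Complex.isPrimitiveRoot_exp r (by omega)
  have h0 : zetaC r ≠ 0 := h.ne_zero (by omega)
  have hM : (Matrix.of fun i j : Fin r => zetaC r ^ ((j.val + 1) * i.val)) =
      (Matrix.vandermonde fun j : Fin r => zetaC r ^ (j.val + 1)).transpose := by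
    ext i j
    simp [Matrix.vandermonde_apply, pow_mul]
  rw [deltaC, hM, Matrix.det_transpose, Matrix.det_vandermonde_ne_zero_iff]
  intro a b hab
  have hab' : zetaC r ^ a.val = zetaC r ^ b.val := by
    simpa [pow_succ, h0] using hab
  exact Fin.ext (h.pow_inj a.isLt b.isLt hab')

theorem det_vand_mul_deltaInv {r : ℕ} (hr : 1 ≤ r) : (vand r).det * deltaInv r = 1 := by
  apply Subtype.val_injective
  have h : ((vand r).det : ℂ) = deltaC r := by
    change (Base r).val (vand r).det = _
    rw [AlgHom.map_det]
    rfl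
  change ((vand r).det : ℂ) * (deltaC r)⁻¹ = 1
  rw [h, mul_inv_cancel₀ (deltaC_ne_zero hr)]

theorem natCast_mul_rInv {r : ℕ} (hr : 1 ≤ r) : (r : Base r) * rInv r = 1 := by
  apply Subtype.val_injective
  change ((r : ℂ)) * ((r : ℂ))⁻¹ = 1
  exact mul_inv_cancel₀ (by exact_mod_cast (by omega : r ≠ 0))

/-- The entries of `A⁻¹`. -/
def vandInv (r : ℕ) (c j : Fin r) : Base r := deltaInv r * (vand r).adjugate c j

theorem sum_vandInv_mul_vand {r : ℕ} (hr : 1 ≤ r) (c d : Fin r) :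
    ∑ j, vandInv r c j * vand r j d = if c = d then 1 else 0 := by
  have h := congrFun (congrFun (Matrix.adjugate_mul (vand r)) c) d
  rw [Matrix.mul_apply] at h
  simp only [vandInv, mul_assoc, ← Finset.mul_sum, h, Matrix.smul_apply, smul_eq_mul,
    Matrix.one_apply]
  rw [← mul_assoc, mul_comm (deltaInv r), det_vand_mul_deltaInv hr, one_mul]

theorem sum_vand_mul_vandInv {r : ℕ} (hr : 1 ≤ r) (i j : Fin r) :
    ∑ c, vand r i c * vandInv r c j = if i = j then 1 else 0 := by
  have h := congrFun (congrFun (Matrix.mul_adjugate (vand r)) i) j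
  rw [Matrix.mul_apply] at h
  simp only [vandInv, mul_left_comm _ (deltaInv r), ← Finset.mul_sum, h, Matrix.smul_apply,
    smul_eq_mul, Matrix.one_apply]
  rw [← mul_assoc, mul_comm (deltaInv r), det_vand_mul_deltaInv hr, one_mul]

/-- For `c = d` every summand is `1`. For distinct roots `a, b` the sum is `b ∑ a^s b^(r-1-s)`, and
`a - b ≠ 0` times that geometric sum is `a^r - b^r = 0` in a domain. -/
theorem rInv_mul_sum_zeta_pow {r : ℕ} (hr : 1 ≤ r) (c d : Fin r) :
    rInv r * ∑ s ∈ Finset.range r, (zeta r ^ (c.val + 1)) ^ s * (zeta r ^ (d.val + 1)) ^ (r - s) =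
      if c = d then 1 else 0 := by
  have hz := isPrimitiveRoot_zeta hr
  have hpow (k : ℕ) : (zeta r ^ k) ^ r = 1 := by
    rw [← pow_mul, mul_comm, pow_mul, hz.pow_eq_one, one_pow]
  split_ifs with h
  · subst h
    rw [Finset.sum_congr rfl (g := fun _ => 1), Finset.sum_const, Finset.card_range, nsmul_eq_mul,
      mul_one, mul_comm, natCast_mul_rInv hr]
    intro s hs
    rw [← pow_add, Nat.add_sub_cancel' (Finset.mem_range.1 hs).le, hpow]
  · have hne : zeta r ^ (c.val + 1) - zeta r ^ (d.val + 1) ≠ 0 := by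
      intro h0
      have h0' := sub_eq_zero.1 h0
      rw [pow_succ, pow_succ] at h0'
      have h1 := mul_right_cancel₀ (hz.ne_zero (by omega)) h0'
      exact h (Fin.ext (hz.pow_inj c.isLt d.isLt h1))
    have hg := (Commute.all (zeta r ^ (c.val + 1)) (zeta r ^ (d.val + 1))).mul_geom_sum₂ r
    rw [hpow, hpow, sub_self] at hg
    have hg' := (mul_eq_zero.1 hg).resolve_left hne
    have : ∑ s ∈ Finset.range r,
        (zeta r ^ (c.val + 1)) ^ s * (zeta r ^ (d.val + 1)) ^ (r - s) =
        (∑ s ∈ Finset.range r,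
          (zeta r ^ (c.val + 1)) ^ s * (zeta r ^ (d.val + 1)) ^ (r - 1 - s)) *
          zeta r ^ (d.val + 1) := by
      rw [Finset.sum_mul]
      refine Finset.sum_congr rfl fun s hs => ?_
      have := Finset.mem_range.1 hs
      rw [mul_assoc, ← pow_succ, show r - 1 - s + 1 = r - s by omega]
    rw [this, hg', zero_mul, mul_zero]

/-! ### Spectral projections of an element of order `r` -/

/-- The `r`-th roots of unity `root c` of a commutative semiring, with the inverse of their
Vandermonde matrix and the inverse of `r`. -/
structure EigenData (K : Type*) [CommSemiring K] (r : ℕ) where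
  root : Fin r → K
  inv : Fin r → Fin r → K
  rInv : K
  r_pos : 0 < r
  root_pow : ∀ c, root c ^ r = 1
  inv_mul : ∀ c d, ∑ j : Fin r, inv c j * root d ^ j.val = if c = d then 1 else 0
  mul_inv : ∀ i j : Fin r, ∑ c, root c ^ i.val * inv c j = if i = j then 1 else 0
  orthogonality : ∀ c d, rInv * ∑ s ∈ Finset.range r, root c ^ s * root d ^ (r - s) =
    if c = d then 1 else 0

namespace EigenData

/-- Transport along a ring homomorphism. -/
def map {K L : Type*} [CommSemiring K] [CommSemiring L] {r : ℕ} (D : EigenData K r) (f : K →+* L) :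
    EigenData L r where
  root c := f (D.root c)
  inv c j := f (D.inv c j)
  rInv := f D.rInv
  r_pos := D.r_pos
  root_pow c := by rw [← map_pow, D.root_pow, map_one]
  inv_mul c d := by
    simp only [← map_pow, ← map_mul, ← map_sum, D.inv_mul, apply_ite f, map_one, map_zero]
  mul_inv i j := by
    simp only [← map_pow, ← map_mul, ← map_sum, D.mul_inv, apply_ite f, map_one, map_zero]
  orthogonality c d := by
    simp only [← map_pow, ← map_mul, ← map_sum, D.orthogonality, apply_ite f, map_one, map_zero]

variable {K A : Type*} [CommSemiring K] [Ring A] [Algebra K A] {r : ℕ} (D : EigenData K r)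

/-- The projection on the eigenspace of `x` for the eigenvalue `root c`. -/
def proj (x : A) (c : Fin r) : A := ∑ j : Fin r, D.inv c j • x ^ j.val

/-- This inverts the definition of `proj` and holds for every `x`; the relation `x ^ r = 1` first
matters for the exponent `r`. -/
theorem pow_eq_sum_proj_of_lt (x : A) (k : Fin r) :
    x ^ k.val = ∑ c : Fin r, D.root c ^ k.val • D.proj x c := by
  simp only [proj, Finset.smul_sum, smul_smul]
  rw [Finset.sum_comm]
  simp only [← Finset.sum_smul, D.mul_inv, ite_smul, one_smul, zero_smul, Finset.sum_ite_eq,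
    Finset.mem_univ, if_true]

theorem sum_proj (x : A) : ∑ c : Fin r, D.proj x c = 1 := by
  have h := D.pow_eq_sum_proj_of_lt x ⟨0, D.r_pos⟩
  simpa using h.symm

theorem pow_succ_eq_sum_proj {x : A} (hx : x ^ r = 1) (k : Fin r) :
    x ^ (k.val + 1) = ∑ c : Fin r, D.root c ^ (k.val + 1) • D.proj x c := by
  rcases Nat.lt_or_ge (k.val + 1) r with hk | hk
  · exact D.pow_eq_sum_proj_of_lt x ⟨k.val + 1, hk⟩
  · have hk' : k.val + 1 = r := by omega
    simp only [hk', hx, D.root_pow, one_smul, D.sum_proj]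

/-- Put `v_d = x E_d - root d • E_d`. Comparing the expansions of `x * x^k` and `x^(k+1)` gives `∑_d
(root d)^k v_d = 0` for all `k < r`, and the inverse Vandermonde matrix then forces every `v_d` to
vanish. -/
theorem mul_proj {x : A} (hx : x ^ r = 1) (c : Fin r) :
    x * D.proj x c = D.root c • D.proj x c := by
  have key (k : Fin r) : ∑ d : Fin r, D.root d ^ k.val •
      (x * D.proj x d - D.root d • D.proj x d) = 0 := by
    simp only [smul_sub, Finset.sum_sub_distrib, smul_smul, ← pow_succ]
    rw [← D.pow_succ_eq_sum_proj hx k, pow_succ', D.pow_eq_sum_proj_of_lt x k, Finset.mul_sum]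
    simp only [mul_smul_comm, sub_self]
  have h2 : ∑ k : Fin r, D.inv c k • ∑ d : Fin r, D.root d ^ k.val •
      (x * D.proj x d - D.root d • D.proj x d) = 0 := by
    simp only [key, smul_zero, Finset.sum_const_zero]
  simp only [Finset.smul_sum, smul_smul] at h2
  rw [Finset.sum_comm] at h2
  simp only [← Finset.sum_smul, D.inv_mul, ite_smul, one_smul, zero_smul, Finset.sum_ite_eq,
    Finset.mem_univ, if_true] at h2
  exact sub_eq_zero.1 h2

theorem pow_mul_proj {x : A} (hx : x ^ r = 1) (c : Fin r) (k : ℕ) :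
    x ^ k * D.proj x c = D.root c ^ k • D.proj x c := by
  induction k with
  | zero => simp
  | succ k ih => rw [pow_succ, mul_assoc, D.mul_proj hx, mul_smul_comm, ih, smul_smul, ← pow_succ']

/-- On the image of `E_d`, the polynomial `E_c` in `x` acts as its value at `root d`, which is `0`
or `1`. -/
theorem proj_mul_proj {x : A} (hx : x ^ r = 1) (c d : Fin r) :
    D.proj x c * D.proj x d = if c = d then D.proj x d else 0 := by
  rw [proj, Finset.sum_mul]
  simp only [smul_mul_assoc, D.pow_mul_proj hx, smul_smul]
  rw [← Finset.sum_smul, D.inv_mul, ite_smul, one_smul, zero_smul]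

theorem pow_eq_sum_proj {x : A} (hx : x ^ r = 1) (k : ℕ) :
    x ^ k = ∑ c : Fin r, D.root c ^ k • D.proj x c := by
  simp only [← D.pow_mul_proj hx, ← Finset.mul_sum, sum_proj, mul_one]

theorem semiconjBy_proj {g x y : A} (h : SemiconjBy g x y) (c : Fin r) :
    SemiconjBy g (D.proj x c) (D.proj y c) := by
  simp only [proj, SemiconjBy, Finset.mul_sum, Finset.sum_mul]
  refine Finset.sum_congr rfl fun j _ => ?_
  rw [mul_smul_comm, smul_mul_assoc, (h.pow_right j.val).eq]

theorem commute_proj_right {x y : A} (h : Commute x y) (c : Fin r) : Commute x (D.proj y c) :=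
  D.semiconjBy_proj h c

theorem commute_proj {x y : A} (h : Commute x y) (c d : Fin r) :
    Commute (D.proj x c) (D.proj y d) :=
  D.commute_proj_right (D.commute_proj_right h.symm c).symm d

/-- The projection `∑ E_c(x) E_d(y)` over the pairs of eigenvalue indices `c < d`. -/
def ltProj (x y : A) : A := ∑ c : Fin r, ∑ d ∈ Finset.Ioi c, D.proj x c * D.proj y d

/-- `(1/r) ∑_s x^s y^{r-s}`. -/
def eqProj (x y : A) : A := D.rInv • ∑ s ∈ Finset.range r, x ^ s * y ^ (r - s)

/-- The scalar `a` is the difference of the two eigenvalues, characterised additively because `K` is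
only a semiring. -/
theorem sub_mul_proj_mul_proj {x y : A} (hx : x ^ r = 1) (hy : y ^ r = 1) (h : Commute x y)
    {c d : Fin r} {a : K} (ha : a + D.root c = D.root d) :
    (y - x) * (D.proj x c * D.proj y d) = a • (D.proj x c * D.proj y d) := by
  rw [sub_mul, ← mul_assoc, (D.commute_proj_right h.symm c).eq, mul_assoc, D.mul_proj hy,
    ← mul_assoc, D.mul_proj hx, mul_smul_comm, smul_mul_assoc, ← ha, add_smul, add_sub_cancel_right]

theorem eqProj_eq_sum {x y : A} (hx : x ^ r = 1) (hy : y ^ r = 1) :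
    D.eqProj x y = ∑ c : Fin r, D.proj x c * D.proj y c := by
  have h1 (s : ℕ) : x ^ s * y ^ (r - s) = ∑ c : Fin r, ∑ d : Fin r,
      (D.root c ^ s * D.root d ^ (r - s)) • (D.proj x c * D.proj y d) := by
    rw [D.pow_eq_sum_proj hx, D.pow_eq_sum_proj hy, Finset.sum_mul_sum]
    simp only [smul_mul_smul_comm]
  simp only [eqProj, h1]
  rw [Finset.sum_comm, Finset.smul_sum]
  refine Finset.sum_congr rfl fun c _ => ?_
  rw [Finset.sum_comm]
  simp only [← Finset.sum_smul, Finset.smul_sum, smul_smul, D.orthogonality, ite_smul, one_smul,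
    zero_smul, Finset.sum_ite_eq, Finset.mem_univ, if_true]

theorem proj_mul_proj_mul {x y : A} (hx : x ^ r = 1) (hy : y ^ r = 1) (h : Commute x y)
    (a b c d : Fin r) : D.proj x a * D.proj y b * (D.proj x c * D.proj y d) =
      if b = d then (if a = c then D.proj x c * D.proj y d else 0) else 0 := by
  rw [mul_assoc, ← mul_assoc (D.proj y b), ← (D.commute_proj h c b).eq, mul_assoc,
    D.proj_mul_proj hy, ← mul_assoc, D.proj_mul_proj hx]
  split_ifs <;> simp

theorem ltProj_mul_proj_mul_proj {x y : A} (hx : x ^ r = 1) (hy : y ^ r = 1)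
    (h : Commute x y) (c d : Fin r) :
    D.ltProj x y * (D.proj x c * D.proj y d) =
      if c < d then D.proj x c * D.proj y d else 0 := by
  simp only [ltProj, Finset.sum_mul, D.proj_mul_proj_mul hx hy h]
  simp only [Finset.sum_ite_eq', Finset.mem_Ioi]
  rw [Finset.sum_eq_single c]
  · simp
  · intro b _ hb
    simp [hb]
  · simp

theorem eqProj_mul_proj_mul_proj {x y : A} (hx : x ^ r = 1) (hy : y ^ r = 1)
    (h : Commute x y) (c d : Fin r) :
    D.eqProj x y * (D.proj x c * D.proj y d) =
      if c = d then D.proj x c * D.proj y d else 0 := by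
  simp only [D.eqProj_eq_sum hx hy, Finset.sum_mul, D.proj_mul_proj_mul hx hy h]
  simp only [Finset.sum_ite_eq', Finset.mem_univ, if_true, eq_comm (a := d)]

theorem semiconjBy_ltProj {g x y x' y' : A} (h : SemiconjBy g x x') (h' : SemiconjBy g y y') :
    SemiconjBy g (D.ltProj x y) (D.ltProj x' y') := by
  simp only [ltProj, SemiconjBy, Finset.mul_sum, Finset.sum_mul]
  exact Finset.sum_congr rfl fun c _ => Finset.sum_congr rfl fun d _ =>
    ((D.semiconjBy_proj h c).mul_right (D.semiconjBy_proj h' d)).eq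

theorem semiconjBy_smul_ltProj (κ : K) {g x y x' y' : A} (h : SemiconjBy g x x')
    (h' : SemiconjBy g y y') : SemiconjBy g (κ • D.ltProj x y) (κ • D.ltProj x' y') := by
  rw [SemiconjBy, mul_smul_comm, smul_mul_assoc, (D.semiconjBy_ltProj h h').eq]

theorem semiconjBy_eqProj {g x y x' y' : A} (h : SemiconjBy g x x') (h' : SemiconjBy g y y') :
    SemiconjBy g (D.eqProj x y) (D.eqProj x' y') := by
  simp only [eqProj, SemiconjBy, mul_smul_comm, smul_mul_assoc, Finset.mul_sum, Finset.sum_mul]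
  congr 1
  exact Finset.sum_congr rfl fun s _ => ((h.pow_right s).mul_right (h'.pow_right (r - s))).eq

theorem eqProj_comm {x y : A} (hx : x ^ r = 1) (hy : y ^ r = 1) (h : Commute x y) :
    D.eqProj x y = D.eqProj y x := by
  rw [D.eqProj_eq_sum hx hy, D.eqProj_eq_sum hy hx]
  exact Finset.sum_congr rfl fun c _ => (D.commute_proj h c c).eq

/-- The products `E_c(x) E_d(y)` sum to `1`, so an identity may be tested on each joint eigenspace.
-/
theorem ext_proj₂ {u v : A} (x y : A)
    (h : ∀ c d, u * (D.proj x c * D.proj y d) = v * (D.proj x c * D.proj y d)) : u = v := by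
  have h1 : (∑ c : Fin r, ∑ d : Fin r, D.proj x c * D.proj y d) = 1 := by
    rw [← Finset.sum_mul_sum, sum_proj, sum_proj, mul_one]
  rw [← mul_one u, ← mul_one v, ← h1]
  simp only [Finset.mul_sum, h]

theorem ext_proj₃ {u v : A} (x y z : A)
    (h : ∀ c d e, u * (D.proj x c * (D.proj y d * D.proj z e)) =
      v * (D.proj x c * (D.proj y d * D.proj z e))) : u = v := by
  have h1 : (∑ c : Fin r, ∑ d : Fin r, ∑ e : Fin r,
      D.proj x c * (D.proj y d * D.proj z e)) = 1 := by
    simp only [← Finset.mul_sum, sum_proj, mul_one]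
  rw [← mul_one u, ← mul_one v, ← h1]
  simp only [Finset.mul_sum, h]

theorem eqProj_one_one : D.eqProj (1 : A) 1 = 1 := by
  rw [D.eqProj_eq_sum (one_pow r) (one_pow r)]
  simp only [D.proj_mul_proj (one_pow r), if_true, sum_proj]

/-- Only pairs `c < d` occur, and distinct projections of the same element are orthogonal. At `x =
1` this makes the correction term disappear in the quotient `t_j = 1`. -/
theorem smul_ltProj_self (κ : K) {x : A} (hx : x ^ r = 1) : κ • D.ltProj x x = 0 := by
  rw [ltProj, Finset.sum_eq_zero, smul_zero]
  refine fun c _ => Finset.sum_eq_zero fun d hd => ?_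
  rw [D.proj_mul_proj hx, if_neg (Finset.mem_Ioi.1 hd).ne]

/-! ### The modified generators `g + κ L(x, y)` -/

section Swap

variable {D} {κ : K} {g x y : A}

/-- Trichotomy for the indices of a joint eigenspace. -/
theorem ltProj_add_eqProj_add_ltProj (hx : x ^ r = 1) (hy : y ^ r = 1) (h : Commute x y) :
    D.ltProj x y + D.eqProj x y + D.ltProj y x = 1 := by
  refine D.ext_proj₂ x y fun c d => ?_
  have h2 := D.ltProj_mul_proj_mul_proj hy hx h.symm d c
  rw [← (D.commute_proj h c d).eq] at h2
  rw [add_mul, add_mul, D.ltProj_mul_proj_mul_proj hx hy h, D.eqProj_mul_proj_mul_proj hx hy h, h2,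
    one_mul]
  rcases lt_trichotomy c d with h | h | h
  · simp [h, h.ne, h.not_gt]
  · simp [h]
  · simp [h, h.ne', h.not_gt]

theorem ltProj_mul_self (hx : x ^ r = 1) (hy : y ^ r = 1) (h : Commute x y) :
    D.ltProj x y * D.ltProj x y = D.ltProj x y := by
  refine D.ext_proj₂ x y fun c d => ?_
  rw [mul_assoc, D.ltProj_mul_proj_mul_proj hx hy h]
  split_ifs with hcd
  · rw [D.ltProj_mul_proj_mul_proj hx hy h, if_pos hcd]
  · rw [mul_zero]

/-- With `L = L(x, y)`, `L' = L(y, x)` and `g L = L' g`, the square is `1 + κ (e + L + L') g + κ²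
L²`. Here `L² = L` and `L + e + L' = 1`. -/
theorem quadratic (hx : x ^ r = 1) (hy : y ^ r = 1) (h : Commute x y) (hxy : SemiconjBy g x y)
    (hyx : SemiconjBy g y x) (hg : g ^ 2 = 1 + κ • (D.eqProj x y * g)) :
    (g + κ • D.ltProj x y) ^ 2 = 1 + κ • (g + κ • D.ltProj x y) := by
  have h1 : g = D.ltProj x y * g + D.eqProj x y * g + D.ltProj y x * g := by
    rw [← add_mul, ← add_mul, ltProj_add_eqProj_add_ltProj hx hy h, one_mul]
  have h2 := (D.semiconjBy_ltProj hxy hyx).eq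
  rw [pow_two] at hg ⊢
  simp only [mul_add, add_mul, smul_mul_assoc, mul_smul_comm, smul_smul, smul_add, h2, hg,
    ltProj_mul_self hx hy h]
  conv_rhs => rw [h1]
  simp only [smul_add]
  abel

/-- The inverse is `g - κ e`. -/
theorem isUnit_of_quadratic {e : A} (he : Commute g e) (hg : g ^ 2 = 1 + κ • (e * g)) :
    IsUnit g := by
  have h1 : g * (g - κ • e) = 1 := by
    rw [mul_sub, ← pow_two, hg, mul_smul_comm, he.eq, add_sub_cancel_right]
  have h2 : (g - κ • e) * g = 1 := by
    rw [sub_mul, ← pow_two, hg, smul_mul_assoc, add_sub_cancel_right]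
  exact ⟨⟨g, g - κ • e, h1, h2⟩, rfl⟩

end Swap

/-! ### The braid relation for the modified generators -/

section Braid

variable {D} {κ : K} {g₁ g₂ x y z : A}

/-- These are the coefficients of `κ² g₁`, of `κ² g₂` and of `κ³` in the braid relation. On the
joint eigenspace of indices `c, d, e` every factor is `0` or `1`, so each identity is a case check
on the relative order of `c, d, e`. -/
theorem ltProj_ltProj_identities (hx : x ^ r = 1) (hy : y ^ r = 1) (hz : z ^ r = 1)
    (hxy : Commute x y) (hxz : Commute x z) (hyz : Commute y z) :
    D.ltProj x y * D.ltProj y z + D.ltProj x z * D.ltProj y x + D.ltProj x z * D.eqProj x y =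
        D.ltProj y z * D.ltProj x z ∧
      D.ltProj y z * D.ltProj x y + D.ltProj x z * D.ltProj z y + D.ltProj x z * D.eqProj y z =
        D.ltProj x y * D.ltProj x z ∧
      D.ltProj x y * D.ltProj y z * D.ltProj x y = D.ltProj y z * D.ltProj x y * D.ltProj y z := by
  -- The three regroupings bring the pair of projections on which a given operator acts to the
  -- front.
  have split (c d e : Fin r) : D.proj x c * (D.proj y d * D.proj z e) =
      (D.proj x c * D.proj y d) * D.proj z e := (mul_assoc _ _ _).symm
  have split' (c d e : Fin r) : D.proj x c * (D.proj y d * D.proj z e) =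
      (D.proj x c * D.proj z e) * D.proj y d := by
    rw [(D.commute_proj hyz d e).eq, mul_assoc]
  have split'' (c d e : Fin r) : D.proj x c * (D.proj y d * D.proj z e) =
      (D.proj y d * D.proj z e) * D.proj x c :=
    ((D.commute_proj hxy c d).mul_right (D.commute_proj hxz c e)).eq
  have l12 (c d e : Fin r) : D.ltProj x y * (D.proj x c * (D.proj y d * D.proj z e)) =
      if c < d then D.proj x c * (D.proj y d * D.proj z e) else 0 := by
    rw [split, ← mul_assoc, D.ltProj_mul_proj_mul_proj hx hy hxy, ite_mul, zero_mul]
  have l21 (c d e : Fin r) : D.ltProj y x * (D.proj x c * (D.proj y d * D.proj z e)) =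
      if d < c then D.proj x c * (D.proj y d * D.proj z e) else 0 := by
    rw [split, (D.commute_proj hxy c d).eq, ← mul_assoc,
      D.ltProj_mul_proj_mul_proj hy hx hxy.symm, ite_mul, zero_mul]
  have e12 (c d e : Fin r) : D.eqProj x y * (D.proj x c * (D.proj y d * D.proj z e)) =
      if c = d then D.proj x c * (D.proj y d * D.proj z e) else 0 := by
    rw [split, ← mul_assoc, D.eqProj_mul_proj_mul_proj hx hy hxy, ite_mul, zero_mul]
  have l13 (c d e : Fin r) : D.ltProj x z * (D.proj x c * (D.proj y d * D.proj z e)) =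
      if c < e then D.proj x c * (D.proj y d * D.proj z e) else 0 := by
    rw [split', ← mul_assoc, D.ltProj_mul_proj_mul_proj hx hz hxz, ite_mul, zero_mul]
  have l23 (c d e : Fin r) : D.ltProj y z * (D.proj x c * (D.proj y d * D.proj z e)) =
      if d < e then D.proj x c * (D.proj y d * D.proj z e) else 0 := by
    rw [split'', ← mul_assoc, D.ltProj_mul_proj_mul_proj hy hz hyz, ite_mul, zero_mul]
  have l32 (c d e : Fin r) : D.ltProj z y * (D.proj x c * (D.proj y d * D.proj z e)) =
      if e < d then D.proj x c * (D.proj y d * D.proj z e) else 0 := by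
    rw [split'', (D.commute_proj hyz d e).eq, ← mul_assoc,
      D.ltProj_mul_proj_mul_proj hz hy hyz.symm, ite_mul, zero_mul]
  have e23 (c d e : Fin r) : D.eqProj y z * (D.proj x c * (D.proj y d * D.proj z e)) =
      if d = e then D.proj x c * (D.proj y d * D.proj z e) else 0 := by
    rw [split'', ← mul_assoc, D.eqProj_mul_proj_mul_proj hy hz hyz, ite_mul, zero_mul]
  refine ⟨?_, ?_, ?_⟩ <;> refine D.ext_proj₃ x y z fun c d e => ?_
  · simp only [add_mul, mul_assoc, l12, l21, l13, l23, e12, mul_ite, mul_zero]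
    split_ifs <;> first | (exfalso; omega) | simp
  · simp only [add_mul, mul_assoc, l12, l32, l13, l23, e23, mul_ite, mul_zero]
    split_ifs <;> first | (exfalso; omega) | simp
  · simp only [mul_assoc, l12, l23, mul_ite, mul_zero]
    split_ifs <;> rfl

/-- Expand both sides in powers of `κ` and move the `L` factors to the left, where `g₁` and `g₂`
permute `x, y, z`. The terms linear in `κ` agree directly; the quadratic relation turns `g₁ L(y, z)
g₁` and `g₂ L(x, y) g₂` into terms that feed `κ²`; the remaining coefficients agree by
`ltProj_ltProj_identities`. -/
theorem braid (hx : x ^ r = 1) (hy : y ^ r = 1) (hz : z ^ r = 1)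
    (hxy : Commute x y) (hxz : Commute x z) (hyz : Commute y z)
    (h1x : SemiconjBy g₁ x y) (h1y : SemiconjBy g₁ y x) (h1z : SemiconjBy g₁ z z)
    (h2x : SemiconjBy g₂ x x) (h2y : SemiconjBy g₂ y z) (h2z : SemiconjBy g₂ z y)
    (hg₁ : g₁ ^ 2 = 1 + κ • (D.eqProj x y * g₁)) (hg₂ : g₂ ^ 2 = 1 + κ • (D.eqProj y z * g₂))
    (hg : g₁ * g₂ * g₁ = g₂ * g₁ * g₂) :
    (g₁ + κ • D.ltProj x y) * (g₂ + κ • D.ltProj y z) * (g₁ + κ • D.ltProj x y) =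
      (g₂ + κ • D.ltProj y z) * (g₁ + κ • D.ltProj x y) * (g₂ + κ • D.ltProj y z) := by
  obtain ⟨i1, i2, i3⟩ := ltProj_ltProj_identities (D := D) hx hy hz hxy hxz hyz
  rw [pow_two] at hg₁ hg₂
  have a1 : g₁ * D.ltProj x y = D.ltProj y x * g₁ := D.semiconjBy_ltProj h1x h1y
  have a2 : g₁ * D.ltProj y z = D.ltProj x z * g₁ := D.semiconjBy_ltProj h1y h1z
  have a3 : g₁ * D.ltProj x z = D.ltProj y z * g₁ := D.semiconjBy_ltProj h1x h1z
  have b1 : g₂ * D.ltProj x y = D.ltProj x z * g₂ := D.semiconjBy_ltProj h2x h2y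
  have b2 : g₂ * D.ltProj y z = D.ltProj z y * g₂ := D.semiconjBy_ltProj h2y h2z
  have b3 : g₂ * D.ltProj x z = D.ltProj x y * g₂ := D.semiconjBy_ltProj h2x h2z
  have m1 : g₁ * D.ltProj y z * g₁ = D.ltProj x z + κ • (D.ltProj x z * D.eqProj x y * g₁) := by
    rw [a2, mul_assoc, hg₁, mul_add, mul_one, mul_smul_comm, mul_assoc]
  have m2 : g₁ * g₂ * D.ltProj x y = D.ltProj y z * g₁ * g₂ := by
    rw [mul_assoc, b1, ← mul_assoc, a3]
  have m3 : D.ltProj x y * g₂ * D.ltProj x y = D.ltProj x y * D.ltProj x z * g₂ := by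
    rw [mul_assoc, b1, mul_assoc]
  have m4 : g₁ * D.ltProj y z * D.ltProj x y = D.ltProj x z * D.ltProj y x * g₁ := by
    rw [a2, mul_assoc, a1, mul_assoc]
  have n1 : g₂ * D.ltProj x y * g₂ = D.ltProj x z + κ • (D.ltProj x z * D.eqProj y z * g₂) := by
    rw [b1, mul_assoc, hg₂, mul_add, mul_one, mul_smul_comm, mul_assoc]
  have n2 : g₂ * g₁ * D.ltProj y z = D.ltProj x y * g₂ * g₁ := by
    rw [mul_assoc, a2, ← mul_assoc, b3]
  have n3 : D.ltProj y z * g₁ * D.ltProj y z = D.ltProj y z * D.ltProj x z * g₁ := by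
    rw [mul_assoc, a2, mul_assoc]
  have n4 : g₂ * D.ltProj x y * D.ltProj y z = D.ltProj x z * D.ltProj z y * g₂ := by
    rw [b1, mul_assoc, b2, mul_assoc]
  simp only [mul_add, add_mul, smul_mul_assoc, mul_smul_comm, smul_smul, smul_add, hg, m1, m2, m3,
    m4, n1, n2, n3, n4, i3, ← i1, ← i2]
  abel

end Braid

end EigenData

/-! ### Compatibility of the three expressions with algebra homomorphisms -/

theorem map_idem {A B : Type*} [Semiring A] [Semiring B] (r : ℕ) [Algebra (Coeff r) A]
    [Algebra (Coeff r) B] (f : A →ₐ[Coeff r] B) (x y : A) :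
    f (idem r x y) = idem r (f x) (f y) := by
  simp [idem]

theorem map_corr {A B : Type*} [Semiring A] [Semiring B] (r : ℕ) [Algebra (Coeff r) A]
    [Algebra (Coeff r) B] (f : A →ₐ[Coeff r] B) (x y : A) :
    f (corr r x y) = corr r (f x) (f y) := by
  simp [corr, Polynomial.aeval_algHom_apply]

theorem map_twist {A B : Type*} [Semiring A] [Semiring B] (r : ℕ) [Algebra (Coeff r) A]
    [Algebra (Coeff r) B] (f : A →ₐ[Coeff r] B) (x y : A) :
    f (twist r x y) = twist r (f x) (f y) := by
  simp [twist, Polynomial.aeval_algHom_apply]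

/-! ### Descending products of braid generators -/

section DescProd

variable {M : Type*} [Monoid M]

/-- The product `g_{k-1} ⋯ g_1 g_0`. -/
def descProd (g : ℕ → M) : ℕ → M
  | 0 => 1
  | k + 1 => g k * descProd g k

theorem descProd_succ (g : ℕ → M) (k : ℕ) : descProd g (k + 1) = g k * descProd g k := rfl

theorem descProd_succ' (g : ℕ → M) (k : ℕ) :
    descProd g (k + 1) = descProd (fun i => g (i + 1)) k * g 0 := by
  induction k with
  | zero => simp [descProd]
  | succ k ih => rw [descProd_succ, ih, ← mul_assoc]; rfl

theorem descProd_congr {g g' : ℕ → M} {k : ℕ} (h : ∀ i < k, g i = g' i) :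
    descProd g k = descProd g' k := by
  induction k with
  | zero => rfl
  | succ k ih =>
    rw [descProd_succ, descProd_succ, h k (by omega), ih fun i hi => h i (by omega)]

theorem map_descProd {N : Type*} [Monoid N] (f : M →* N) (g : ℕ → M) (k : ℕ) :
    f (descProd g k) = descProd (fun i => f (g i)) k := by
  induction k with
  | zero => exact map_one f
  | succ k ih => rw [descProd_succ, map_mul, ih, descProd_succ]

theorem commute_descProd {g : ℕ → M} {x : M} {k : ℕ} (h : ∀ i < k, Commute x (g i)) :
    Commute x (descProd g k) := by
  induction k with
  | zero => exact Commute.one_right x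
  | succ k ih => exact (h k (by omega)).mul_right (ih fun i hi => h i (by omega))

theorem isUnit_descProd {g : ℕ → M} {k : ℕ} (h : ∀ i < k, IsUnit (g i)) :
    IsUnit (descProd g k) := by
  induction k with
  | zero => exact isUnit_one
  | succ k ih => exact (h k (by omega)).mul (ih fun i hi => h i (by omega))

theorem descProd_eq_prod (g : ℕ → M) (k : ℕ) :
    ((List.finRange k).map fun i => g i.val).reverse.prod = descProd g k := by
  have h : ((List.finRange k).map fun i => g i.val) = (List.range k).map g := by
    rw [← List.map_coe_finRange_eq_range, List.map_map]
    rfl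
  rw [h]
  induction k with
  | zero => rfl
  | succ k ih =>
    rw [List.range_succ, List.map_append, List.reverse_append, List.prod_append, ih
      (by rw [← List.map_coe_finRange_eq_range, List.map_map]; rfl)]
    simp [descProd_succ]

/-- The braid relations for `g_0, …, g_{m-1}`. -/
structure BraidRel (m : ℕ) (g : ℕ → M) : Prop where
  comm : ∀ i j, j < m → i + 2 ≤ j → Commute (g i) (g j)
  braid : ∀ i, i + 1 < m → g i * g (i + 1) * g i = g (i + 1) * g i * g (i + 1)

variable {m : ℕ} {g : ℕ → M}

/-- The factors below `g i` commute with `g (i + 1)`, the braid relation turns `g (i + 1)` into `g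
i`, and the factors above `g (i + 1)` commute with `g i`. -/
theorem BraidRel.semiconjBy_descProd (hg : BraidRel m g) {k i : ℕ} (hk : k < m) (hi : i < k) :
    SemiconjBy (descProd g (k + 1)) (g (i + 1)) (g i) := by
  induction k with
  | zero => omega
  | succ k ih =>
    rw [descProd_succ]
    rcases Nat.lt_or_ge i k with h | h
    · exact SemiconjBy.mul_left (hg.comm i (k + 1) hk (by omega)).symm (ih (by omega) h)
    · obtain rfl : i = k := by omega
      have hc : Commute (g (i + 1)) (descProd g i) :=
        commute_descProd fun j hj => (hg.comm j (i + 1) hk (by omega)).symm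
      rw [descProd_succ, SemiconjBy]
      calc g (i + 1) * (g i * descProd g i) * g (i + 1)
          = g (i + 1) * g i * (descProd g i * g (i + 1)) := by simp only [mul_assoc]
        _ = g (i + 1) * g i * g (i + 1) * descProd g i := by rw [← hc.eq]; simp only [mul_assoc]
        _ = g i * (g (i + 1) * (g i * descProd g i)) := by
          rw [← hg.braid i hk]; simp only [mul_assoc]

theorem BraidRel.descProd_mul_descProd (hg : BraidRel m g) {k j : ℕ} (hk : k < m) (hj : j ≤ k) :
    descProd g (k + 1) * descProd (fun i => g (i + 1)) j = descProd g j * descProd g (k + 1) := by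
  induction j with
  | zero => simp [descProd]
  | succ j ih =>
    rw [descProd_succ _ j, descProd_succ g j, ← mul_assoc, (hg.semiconjBy_descProd hk (by omega)).eq,
      mul_assoc, ih (by omega), mul_assoc]

/-- `g_k` and `g_0` are conjugate under `(g_k ⋯ g_0) (g_k ⋯ g_1)`. -/
theorem BraidRel.mul_descProd_mul_descProd (hg : BraidRel m g) {k : ℕ} (hk : k < m) :
    g k * (descProd g (k + 1) * descProd (fun i => g (i + 1)) k) =
      descProd g (k + 1) * descProd (fun i => g (i + 1)) k * g 0 := by
  rw [mul_assoc _ _ (g 0), ← descProd_succ', hg.descProd_mul_descProd hk le_rfl, ← mul_assoc,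
    ← descProd_succ]

variable {X : M}

theorem BraidRel.semiconjBy_descProd_mul (hg : BraidRel m g)
    (hX : ∀ i, 1 ≤ i → i < m → Commute (g i) X) {i : ℕ} (hi : i + 1 < m) :
    SemiconjBy (descProd g m * X) (g (i + 1)) (g i) := by
  obtain ⟨k, rfl⟩ : ∃ k, m = k + 1 := ⟨m - 1, by omega⟩
  exact (hg.semiconjBy_descProd (Nat.lt_succ_self k) (by omega)).mul_left
    (hX (i + 1) (by omega) hi).symm

/-- This isolates `X g_0 X` at the right end of `ρ²`. Since the product in front of it conjugates
`g_0` to `g_k`, the affine relation (that `g_0` commutes with `X g_0 X`) becomes equivalent to `ρ²`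
conjugating `g_0` to `g_k` when the `g_i` are units. -/
theorem descProd_mul_sq {k : ℕ} (hX : ∀ i, 1 ≤ i → i < k + 1 → Commute (g i) X) :
    descProd g (k + 1) * X * (descProd g (k + 1) * X) =
      descProd g (k + 1) * descProd (fun i => g (i + 1)) k * (X * g 0 * X) := by
  have hc : Commute X (descProd (fun i => g (i + 1)) k) :=
    commute_descProd fun i hi => (hX (i + 1) (by omega) (by omega)).symm
  calc descProd g (k + 1) * X * (descProd g (k + 1) * X)
      = descProd g (k + 1) * X * (descProd (fun i => g (i + 1)) k * g 0 * X) := by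
        nth_rw 2 [descProd_succ']
    _ = descProd g (k + 1) * (X * descProd (fun i => g (i + 1)) k) * (g 0 * X) := by
        simp only [mul_assoc]
    _ = _ := by rw [hc.eq]; simp only [mul_assoc]

theorem BraidRel.semiconjBy_descProd_mul_sq {k : ℕ} (hg : BraidRel (k + 1) g)
    (hX : ∀ i, 1 ≤ i → i < k + 1 → Commute (g i) X) (h0 : g 0 * X * g 0 * X = X * g 0 * X * g 0) :
    SemiconjBy (descProd g (k + 1) * X * (descProd g (k + 1) * X)) (g 0) (g k) := by
  rw [SemiconjBy, descProd_mul_sq hX, ← mul_assoc (g k),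
    hg.mul_descProd_mul_descProd (Nat.lt_succ_self k), mul_assoc, ← h0]
  simp only [mul_assoc]

/-- Both `g_{m-1} ⋯ g_0` and its product with `X` carry `g_i` to `g_{i-1}`; cancelling the
invertible product leaves `X` commuting with `g_i`. -/
theorem BraidRel.commute_of_semiconjBy (hg : BraidRel m g) (hu : ∀ i < m, IsUnit (g i))
    (h : ∀ i, i + 1 < m → SemiconjBy (descProd g m * X) (g (i + 1)) (g i)) {i : ℕ} (h1 : 1 ≤ i)
    (hi : i < m) : Commute (g i) X := by
  obtain ⟨k, rfl⟩ : ∃ k, m = k + 1 := ⟨m - 1, by omega⟩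
  obtain ⟨i, rfl⟩ : ∃ j, i = j + 1 := ⟨i - 1, by omega⟩
  apply (isUnit_descProd hu).mul_left_cancel
  rw [← mul_assoc, (hg.semiconjBy_descProd (Nat.lt_succ_self k) (by omega)).eq, mul_assoc,
    ← (h i hi).eq, mul_assoc]

theorem BraidRel.affine_of_semiconjBy {k : ℕ} (hg : BraidRel (k + 1) g)
    (hu : ∀ i < k + 1, IsUnit (g i)) (hX : ∀ i, 1 ≤ i → i < k + 1 → Commute (g i) X)
    (h : SemiconjBy (descProd g (k + 1) * X * (descProd g (k + 1) * X)) (g 0) (g k)) :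
    g 0 * X * g 0 * X = X * g 0 * X * g 0 := by
  have hu' : IsUnit (descProd g (k + 1) * descProd (fun i => g (i + 1)) k) :=
    (isUnit_descProd hu).mul (isUnit_descProd fun i hi => hu (i + 1) (by omega))
  rw [SemiconjBy, descProd_mul_sq hX, ← mul_assoc (g k),
    hg.mul_descProd_mul_descProd (Nat.lt_succ_self k), mul_assoc,
    mul_assoc (descProd g (k + 1) * _) (g 0)] at h
  have := hu'.mul_left_cancel h
  simpa only [mul_assoc] using this.symm

/-- Conjugation by `g_{m-1} ⋯ g_0` shifts a family that the `g_i` permute by transpositions. -/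
theorem semiconjBy_descProd_of_swap {t : ℕ → M} {m : ℕ}
    (h1 : ∀ k < m, SemiconjBy (g k) (t k) (t (k + 1)))
    (h2 : ∀ k < m, SemiconjBy (g k) (t (k + 1)) (t k))
    (h3 : ∀ k < m, ∀ a ≤ m, a ≠ k → a ≠ k + 1 → Commute (g k) (t a)) {k : ℕ} (hk : k ≤ m) :
    SemiconjBy (descProd g k) (t 0) (t k) ∧
      (∀ a < k, SemiconjBy (descProd g k) (t (a + 1)) (t a)) ∧
      ∀ a ≤ m, k < a → Commute (descProd g k) (t a) := by
  induction k with
  | zero =>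
    exact ⟨SemiconjBy.one_left _, fun a ha => by omega, fun a _ _ => Commute.one_left _⟩
  | succ k ih =>
    obtain ⟨i1, i2, i3⟩ := ih (by omega)
    refine ⟨(h1 k hk).mul_left i1, fun a ha => ?_, fun a ha hka => ?_⟩
    · rcases Nat.lt_or_ge a k with h | h
      · exact SemiconjBy.mul_left (h3 k hk a (by omega) (by omega) (by omega)) (i2 a h)
      · obtain rfl : a = k := by omega
        exact (h2 a hk).mul_left (i3 (a + 1) hk (by omega))
    · exact SemiconjBy.mul_left (h3 k hk a ha (by omega) (by omega)) (i3 a ha (by omega))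

/-- Transport of a relation along conjugation by a unit; it spreads the relations from index `1` to
all indices modulo `n`. -/
theorem eq_of_semiconjBy {a u u' v v' : M} (ha : IsUnit a) (hu : SemiconjBy a u u')
    (hv : SemiconjBy a v v') (h : u = v) : u' = v' := by
  apply ha.mul_right_cancel
  rw [← hu.eq, ← hv.eq, h]

end DescProd

/-! ### Indices modulo `n` -/

theorem exists_eq_natCast_succ {n : ℕ} (hn : 2 ≤ n) (i : ZMod n) :
    ∃ a < n, i = ((a + 1 : ℕ) : ZMod n) := by
  have : NeZero n := ⟨by omega⟩
  refine ⟨(i - 1).val, ZMod.val_lt _, ?_⟩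
  rw [Nat.cast_add, ZMod.natCast_zmod_val, Nat.cast_one, sub_add_cancel]

theorem natCast_succ_injOn {n a b : ℕ} (ha : a < n) (hb : b < n)
    (h : ((a + 1 : ℕ) : ZMod n) = ((b + 1 : ℕ) : ZMod n)) : a = b := by
  push_cast at h
  have h' := (ZMod.natCast_eq_natCast_iff' a b n).1 (add_right_cancel h)
  rwa [Nat.mod_eq_of_lt ha, Nat.mod_eq_of_lt hb] at h'

theorem natCast_succ_ne_zero {n a : ℕ} (ha : a < n - 1) : ((a + 1 : ℕ) : ZMod n) ≠ 0 := by
  intro h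
  have := Nat.le_of_dvd (by omega) ((ZMod.natCast_eq_zero_iff _ _).1 h)
  omega

theorem exists_eq_natCast_succ_of_ne_zero {n : ℕ} (hn : 2 ≤ n) {i : ZMod n} (hi : i ≠ 0) :
    ∃ a < n - 1, i = ((a + 1 : ℕ) : ZMod n) := by
  obtain ⟨a, ha, rfl⟩ := exists_eq_natCast_succ hn i
  refine ⟨a, ?_, rfl⟩
  by_contra h
  exact hi (by rw [show a + 1 = n by omega, ZMod.natCast_self])

/-! ### Families satisfying the defining relations -/

section Systems

variable {K A : Type*} [CommSemiring K] [Ring A] [Algebra K A] {r n : ℕ}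

/-- The defining relations of the extended affine Hecke algebra. -/
structure HeckeSystem (κ : K) (s : ZMod n → A) (ρ ρi : A) : Prop where
  rho_s : ∀ i, ρ * s i = s (i - 1) * ρ
  s_comm : ∀ i j, i - j ≠ 1 → i - j ≠ -1 → s i * s j = s j * s i
  s_braid : 3 ≤ n → ∀ i, s i * s (i + 1) * s i = s (i + 1) * s i * s (i + 1)
  s_sq : ∀ i, s i ^ 2 = 1 + κ • s i
  rho_rhoInv : ρ * ρi = 1
  rhoInv_rho : ρi * ρ = 1

/-- The defining relations of `Ŷ_{r,n}`, with `t_{i+1}` at the index `i + 1 : ZMod n` and `g_{i+1}`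
written `g i`. -/
structure YokonumaSystem (D : EigenData K r) (κ : K) (t : ZMod n → A) (g : ℕ → A) (X Xi : A) :
    Prop where
  braidRel : BraidRel (n - 1) g
  t_comm : ∀ i j, Commute (t i) (t j)
  g_t : ∀ i < n - 1, ∀ j,
    g i * t j = t (Equiv.swap ((i + 1 : ℕ) : ZMod n) (((i + 1 : ℕ) : ZMod n) + 1) j) * g i
  t_pow : ∀ i, t i ^ r = 1
  g_sq : ∀ i < n - 1,
    g i ^ 2 = 1 + κ • (D.eqProj (t ((i + 1 : ℕ) : ZMod n)) (t (((i + 1 : ℕ) : ZMod n) + 1)) * g i)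
  X_Xinv : X * Xi = 1
  Xinv_X : Xi * X = 1
  g_X_zero : g 0 * X * g 0 * X = X * g 0 * X * g 0
  g_X : ∀ i, 1 ≤ i → i < n - 1 → Commute (g i) X
  t_X : ∀ j, Commute (t j) X

/-- The relations of `Ĉ^aff_{r,n}` between the `w_j` and the other generators. -/
structure MixedSystem (D : EigenData K r) (κ : K) (w s : ZMod n → A) (ρ : A) : Prop where
  w_pow : ∀ i, w i ^ r = 1
  w_comm : ∀ i j, Commute (w i) (w j)
  rho_w : ∀ j, ρ * w j = w (j - 1) * ρ
  s_w : ∀ i, i ≠ 0 → s i * w i =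
    w (i + 1) * s i - (w (i + 1) - w i) * (κ • D.ltProj (w i) (w (i + 1)))
  s_w_succ : ∀ i, i ≠ 0 → s i * w (i + 1) =
    w i * s i + (w (i + 1) - w i) * (κ • D.ltProj (w i) (w (i + 1)))
  s_w_comm : ∀ i l, i ≠ 0 → l ≠ i → l ≠ i + 1 → s i * w l = w l * s i

/-! #### From `Ŷ_{r,n}` to `Ĉ^aff_{r,n}` -/

namespace YokonumaSystem

variable {D : EigenData K r} {κ : K} {t : ZMod n → A} {g : ℕ → A} {X Xi : A}

theorem semiconjBy_t (h : YokonumaSystem D κ t g X Xi) {k : ℕ} (hk : k < n - 1) :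
    SemiconjBy (g k) (t ((k + 1 : ℕ) : ZMod n)) (t ((k + 1 + 1 : ℕ) : ZMod n)) := by
  have := h.g_t k hk ((k + 1 : ℕ) : ZMod n)
  rw [Equiv.swap_apply_left] at this
  rw [Nat.cast_succ (k + 1)]
  exact this

theorem semiconjBy_t_succ (h : YokonumaSystem D κ t g X Xi) {k : ℕ} (hk : k < n - 1) :
    SemiconjBy (g k) (t ((k + 1 + 1 : ℕ) : ZMod n)) (t ((k + 1 : ℕ) : ZMod n)) := by
  have := h.g_t k hk (((k + 1 : ℕ) : ZMod n) + 1)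
  rw [Equiv.swap_apply_right] at this
  rw [Nat.cast_succ (k + 1)]
  exact this

theorem commute_t (h : YokonumaSystem D κ t g X Xi) {k a : ℕ} (hk : k < n - 1) (ha : a < n)
    (h1 : a ≠ k) (h2 : a ≠ k + 1) : Commute (g k) (t ((a + 1 : ℕ) : ZMod n)) := by
  have := h.g_t k hk ((a + 1 : ℕ) : ZMod n)
  rwa [Equiv.swap_apply_of_ne_of_ne] at this
  · exact fun h' => h1 (natCast_succ_injOn ha (by omega) h')
  · rw [← Nat.cast_succ (k + 1)]
    exact fun h' => h2 (natCast_succ_injOn ha (by omega) h')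

theorem g_sq' (h : YokonumaSystem D κ t g X Xi) {k : ℕ} (hk : k < n - 1) :
    g k ^ 2 = 1 +
      κ • (D.eqProj (t ((k + 1 : ℕ) : ZMod n)) (t ((k + 1 + 1 : ℕ) : ZMod n)) * g k) := by
  rw [Nat.cast_succ (k + 1)]
  exact h.g_sq k hk

theorem isUnit_g (h : YokonumaSystem D κ t g X Xi) {k : ℕ} (hk : k < n - 1) : IsUnit (g k) := by
  refine EigenData.isUnit_of_quadratic ?_ (h.g_sq' hk)
  have := D.semiconjBy_eqProj (h.semiconjBy_t hk) (h.semiconjBy_t_succ hk)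
  rwa [D.eqProj_comm (x := t ((k + 1 + 1 : ℕ) : ZMod n)) (h.t_pow _) (h.t_pow _)
    (h.t_comm _ _)] at this

theorem isUnit_rho (h : YokonumaSystem D κ t g X Xi) : IsUnit (descProd g (n - 1) * X) :=
  (isUnit_descProd fun _ hi => h.isUnit_g hi).mul ⟨⟨X, Xi, h.X_Xinv, h.Xinv_X⟩, rfl⟩

/-- The image of `h_{s_{k+1}}`. -/
def hecke (D : EigenData K r) (κ : K) (t : ZMod n → A) (g : ℕ → A) (k : ℕ) : A :=
  g k + κ • D.ltProj (t ((k + 1 : ℕ) : ZMod n)) (t ((k + 1 + 1 : ℕ) : ZMod n))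

theorem hecke_sq (h : YokonumaSystem D κ t g X Xi) {k : ℕ} (hk : k < n - 1) :
    hecke D κ t g k ^ 2 = 1 + κ • hecke D κ t g k :=
  EigenData.quadratic (h.t_pow _) (h.t_pow _) (h.t_comm _ _) (h.semiconjBy_t hk)
    (h.semiconjBy_t_succ hk) (h.g_sq' hk)

theorem hecke_braid (h : YokonumaSystem D κ t g X Xi) {k : ℕ} (hk : k + 1 < n - 1) :
    hecke D κ t g k * hecke D κ t g (k + 1) * hecke D κ t g k =
      hecke D κ t g (k + 1) * hecke D κ t g k * hecke D κ t g (k + 1) :=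
  EigenData.braid (h.t_pow _) (h.t_pow _) (h.t_pow _) (h.t_comm _ _) (h.t_comm _ _) (h.t_comm _ _)
    (h.semiconjBy_t (by omega)) (h.semiconjBy_t_succ (by omega))
    (h.commute_t (a := k + 1 + 1) (by omega) (by omega) (by omega) (by omega))
    (h.commute_t hk (by omega) (by omega) (by omega))
    (h.semiconjBy_t hk) (h.semiconjBy_t_succ hk) (h.g_sq' (by omega)) (h.g_sq' hk)
    (h.braidRel.braid k hk)

theorem hecke_comm (h : YokonumaSystem D κ t g X Xi) {k l : ℕ} (hkl : k + 2 ≤ l)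
    (hl : l < n - 1) : Commute (hecke D κ t g k) (hecke D κ t g l) := by
  have h1 : Commute (g k) (hecke D κ t g l) := (h.braidRel.comm k l hl hkl).add_right
    (D.semiconjBy_smul_ltProj κ (h.commute_t (by omega) (by omega) (by omega) (by omega))
      (h.commute_t (a := l + 1) (by omega) (by omega) (by omega) (by omega)))
  have h2 (a : ℕ) (ha : a < n) (hal : a < l) :
      Commute (t ((a + 1 : ℕ) : ZMod n)) (hecke D κ t g l) :=
    (h.commute_t hl ha (by omega) (by omega)).symm.add_right
      (D.semiconjBy_smul_ltProj κ (h.t_comm _ _) (h.t_comm _ _))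
  have h3 : Commute (hecke D κ t g l) (κ • D.ltProj (t ((k + 1 : ℕ) : ZMod n))
      (t ((k + 1 + 1 : ℕ) : ZMod n))) :=
    D.semiconjBy_smul_ltProj κ (h2 k (by omega) (by omega)).symm
      (h2 (k + 1) (by omega) (by omega)).symm
  exact h1.add_left h3.symm

theorem rho_t (h : YokonumaSystem D κ t g X Xi) (hn : 2 ≤ n) (j : ZMod n) :
    SemiconjBy (descProd g (n - 1) * X) (t j) (t (j - 1)) := by
  obtain ⟨h1, h2, -⟩ := semiconjBy_descProd_of_swap (m := n - 1) (g := g)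
    (t := fun a => t ((a + 1 : ℕ) : ZMod n)) (fun k hk => h.semiconjBy_t hk)
    (fun k hk => h.semiconjBy_t_succ hk)
    (fun k hk a ha h1 h2 => h.commute_t hk (by omega) h1 h2) le_rfl
  refine SemiconjBy.mul_left ?_ (h.t_X j).symm
  obtain ⟨a, ha, rfl⟩ := exists_eq_natCast_succ hn j
  rw [Nat.cast_succ, add_sub_cancel_right, ← Nat.cast_succ]
  rcases a with - | a
  · have h3 : t ((n - 1 + 1 : ℕ) : ZMod n) = t ((0 : ℕ) : ZMod n) := by
      rw [Nat.sub_add_cancel (by omega), ZMod.natCast_self, Nat.cast_zero]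
    rw [← h3]
    exact h1
  · exact h2 a (by omega)

theorem rho_hecke (h : YokonumaSystem D κ t g X Xi) (hn : 2 ≤ n) {k : ℕ} (hk : k + 1 < n - 1) :
    SemiconjBy (descProd g (n - 1) * X) (hecke D κ t g (k + 1)) (hecke D κ t g k) := by
  refine (h.braidRel.semiconjBy_descProd_mul h.g_X hk).add_right (D.semiconjBy_smul_ltProj κ ?_ ?_)
  · have := h.rho_t hn ((k + 1 + 1 : ℕ) : ZMod n)
    rw [Nat.cast_succ (k + 1), add_sub_cancel_right] at this
    rwa [Nat.cast_succ (k + 1)]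
  · have := h.rho_t hn ((k + 1 + 1 + 1 : ℕ) : ZMod n)
    rw [Nat.cast_succ (k + 1 + 1), add_sub_cancel_right] at this
    rwa [Nat.cast_succ (k + 1 + 1)]

/-- With no `g` at the index `0`, this closes the cycle: it makes `ρ h_{s_1} ρ⁻¹` a consistent
choice of `h_{s_0}`, carried by `ρ` to `h_{s_{n-1}}`. -/
theorem rho_sq_hecke (h : YokonumaSystem D κ t g X Xi) (hn : 2 ≤ n) :
    SemiconjBy (descProd g (n - 1) * X * (descProd g (n - 1) * X))
      (hecke D κ t g 0) (hecke D κ t g (n - 2)) := by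
  obtain ⟨k, rfl⟩ : ∃ k, n = k + 2 := ⟨n - 2, by omega⟩
  refine (h.braidRel.semiconjBy_descProd_mul_sq h.g_X h.g_X_zero).add_right
    (D.semiconjBy_smul_ltProj κ ?_ ?_)
  · have := (h.rho_t hn _).mul_left (h.rho_t hn ((0 + 1 : ℕ) : ZMod (k + 2)))
    have e : ((0 + 1 : ℕ) : ZMod (k + 2)) - 1 - 1 = ((k + 2 - 2 + 1 : ℕ) : ZMod (k + 2)) := by
      have := ZMod.natCast_self (k + 2)
      push_cast at this ⊢
      linear_combination -this
    rwa [e] at this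
  · have := (h.rho_t hn _).mul_left (h.rho_t hn ((0 + 1 + 1 : ℕ) : ZMod (k + 2)))
    have e : ((0 + 1 + 1 : ℕ) : ZMod (k + 2)) - 1 - 1 =
        ((k + 2 - 2 + 1 + 1 : ℕ) : ZMod (k + 2)) := by
      have := ZMod.natCast_self (k + 2)
      push_cast at this ⊢
      linear_combination -this
    rwa [e] at this

theorem exists_heckeSystem (h : YokonumaSystem D κ t g X Xi) (hn : 2 ≤ n) :
    ∃ (s : ZMod n → A) (ρi : A), HeckeSystem κ s (descProd g (n - 1) * X) ρi ∧
      MixedSystem D κ t s (descProd g (n - 1) * X) ∧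
      ∀ k < n - 1, s ((k + 1 : ℕ) : ZMod n) = hecke D κ t g k := by
  have hu := h.isUnit_rho
  have ht := h.rho_t hn
  have h1 := fun k hk => h.rho_hecke hn (k := k) hk
  have h2 := h.rho_sq_hecke hn
  generalize descProd g (n - 1) * X = ρ at hu ht h1 h2 ⊢
  obtain ⟨ρ, rfl⟩ := hu
  -- The value at `0` is forced by `ρ s_1 = s_0 ρ`; elsewhere `i - 1` accounts for `hecke` being
  -- numbered from `0`.
  let s : ZMod n → A := fun i =>
    if i = 0 then ρ * hecke D κ t g 0 * (ρ⁻¹ : Aˣ) else hecke D κ t g ((i - 1).val)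
  have s_zero : s 0 = ρ * hecke D κ t g 0 * (ρ⁻¹ : Aˣ) := if_pos rfl
  have s_succ : ∀ k < n - 1, s ((k + 1 : ℕ) : ZMod n) = hecke D κ t g k := by
    intro k hk
    simp only [s]
    rw [if_neg (natCast_succ_ne_zero hk), Nat.cast_succ, add_sub_cancel_right,
      ZMod.val_cast_of_lt (by omega)]
  have s_one : s 1 = hecke D κ t g 0 := by simpa using s_succ 0 (by omega)
  have rho_s : ∀ i, SemiconjBy (ρ : A) (s i) (s (i - 1)) := by
    intro i
    by_cases hi : i = 0
    · subst hi
      have e : (0 : ZMod n) - 1 = ((n - 2 + 1 : ℕ) : ZMod n) := by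
        have := ZMod.natCast_self n
        rw [show n - 2 + 1 = n - 1 by omega, Nat.cast_sub (by omega), this, Nat.cast_one]
      rw [e, s_succ _ (by omega), s_zero, SemiconjBy, ← mul_assoc, ← mul_assoc, h2.eq,
        ← mul_assoc, mul_assoc, Units.mul_inv, mul_one]
    · obtain ⟨k, hk, rfl⟩ := exists_eq_natCast_succ_of_ne_zero hn hi
      rw [s_succ k hk, Nat.cast_succ, add_sub_cancel_right]
      rcases k with - | k
      · rw [Nat.cast_zero, s_zero, SemiconjBy, mul_assoc, Units.inv_mul, mul_one]
      · rw [s_succ k (by omega)]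
        exact h1 k hk
  have rho_pow_s (k : ℕ) : ∀ i, SemiconjBy ((ρ : A) ^ k) (s (i + k)) (s i) := by
    induction k with
    | zero => intro i; rw [pow_zero, Nat.cast_zero, add_zero]; exact SemiconjBy.one_left _
    | succ k ih =>
      intro i
      rw [pow_succ]
      refine (ih i).mul_left ?_
      have := rho_s (i + (k + 1 : ℕ))
      rw [Nat.cast_succ, ← add_assoc, add_sub_cancel_right] at this
      rwa [Nat.cast_succ, ← add_assoc]
  -- A power of `ρ` rotates the index `1` to `i`, so each relation need only be checked when its
  -- first index is `1`.
  have rot : ∀ i : ZMod n, ∃ a : A, IsUnit a ∧ ∀ j, SemiconjBy a (s (1 + (j - i))) (s j) := by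
    intro i
    have : NeZero n := ⟨by omega⟩
    refine ⟨(ρ : A) ^ (1 - i).val, ρ.isUnit.pow _, fun j => ?_⟩
    have := rho_pow_s (1 - i).val j
    rwa [ZMod.natCast_zmod_val, show j + (1 - i) = 1 + (j - i) by ring] at this
  refine ⟨s, (ρ⁻¹ : Aˣ), ⟨rho_s, ?_, ?_, ?_, Units.mul_inv _, Units.inv_mul _⟩,
    ⟨h.t_pow, h.t_comm, ht, ?_, ?_, ?_⟩, s_succ⟩
  · intro i j hij hij'
    obtain ⟨a, ha, hs⟩ := rot i
    have hi := hs i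
    rw [sub_self, add_zero, s_one] at hi
    have hj := hs j
    refine eq_of_semiconjBy ha (hi.mul_right hj) (hj.mul_right hi) ?_
    -- After rotation the first index is `1`; the hypotheses exclude `0` and `2` as the second, so
    -- it is `1` itself or a distant index in the finite part.
    have hne : 1 + (j - i) ≠ 0 := fun h0 => hij (by linear_combination -h0)
    obtain ⟨b, hb, hb'⟩ := exists_eq_natCast_succ_of_ne_zero hn hne
    rw [hb', s_succ b hb]
    rcases b with - | - | b
    · rfl
    · exact absurd (by push_cast at hb'; linear_combination -hb') hij'
    · exact h.hecke_comm (by omega) hb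
  · intro hn3 i
    obtain ⟨a, ha, hs⟩ := rot i
    have hi := hs i
    have hj := hs (i + 1)
    rw [sub_self, add_zero, s_one] at hi
    rw [add_sub_cancel_left, show (1 : ZMod n) + 1 = ((1 + 1 : ℕ) : ZMod n) by norm_num,
      s_succ 1 (by omega)] at hj
    exact eq_of_semiconjBy ha ((hi.mul_right hj).mul_right hi) ((hj.mul_right hi).mul_right hj)
      (h.hecke_braid (k := 0) (by omega))
  · intro i
    obtain ⟨a, ha, hs⟩ := rot i
    have hi := hs i
    rw [sub_self, add_zero, s_one] at hi
    have hi' : SemiconjBy a (κ • hecke D κ t g 0) (κ • s i) := by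
      rw [SemiconjBy, mul_smul_comm, hi.eq, smul_mul_assoc]
    exact eq_of_semiconjBy ha (hi.pow_right 2) ((SemiconjBy.one_right a).add_right hi')
      (h.hecke_sq (by omega))
  · intro i hi
    obtain ⟨k, hk, rfl⟩ := exists_eq_natCast_succ_of_ne_zero hn hi
    -- Only `g_k` permutes the `t_j`; the correction commutes with them, and this discrepancy is
    -- exactly `(w_{i+1} - w_i) κ L`.
    rw [← Nat.cast_succ (k + 1), s_succ k hk, hecke, add_mul, mul_add, (h.semiconjBy_t hk).eq,
      sub_mul]
    have : Commute (t ((k + 1 : ℕ) : ZMod n)) (κ • D.ltProj (t ((k + 1 : ℕ) : ZMod n))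
      (t ((k + 1 + 1 : ℕ) : ZMod n))) := D.semiconjBy_smul_ltProj κ (h.t_comm _ _) (h.t_comm _ _)
    rw [this.eq]
    abel
  · intro i hi
    obtain ⟨k, hk, rfl⟩ := exists_eq_natCast_succ_of_ne_zero hn hi
    rw [← Nat.cast_succ (k + 1), s_succ k hk, hecke, add_mul, mul_add,
      (h.semiconjBy_t_succ hk).eq, sub_mul]
    have : Commute (t ((k + 1 + 1 : ℕ) : ZMod n)) (κ • D.ltProj (t ((k + 1 : ℕ) : ZMod n))
      (t ((k + 1 + 1 : ℕ) : ZMod n))) := D.semiconjBy_smul_ltProj κ (h.t_comm _ _) (h.t_comm _ _)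
    rw [this.eq]
    abel
  · intro i l hi hl hl'
    obtain ⟨k, hk, rfl⟩ := exists_eq_natCast_succ_of_ne_zero hn hi
    obtain ⟨a, ha, rfl⟩ := exists_eq_natCast_succ hn l
    rw [s_succ k hk]
    have hc : Commute (g k) (t ((a + 1 : ℕ) : ZMod n)) := by
      refine h.commute_t hk ha ?_ ?_
      · rintro rfl; exact hl rfl
      · rintro rfl; exact hl' (Nat.cast_succ _)
    have hc' : Commute (t ((a + 1 : ℕ) : ZMod n)) (κ • D.ltProj (t ((k + 1 : ℕ) : ZMod n))
      (t ((k + 1 + 1 : ℕ) : ZMod n))) := D.semiconjBy_smul_ltProj κ (h.t_comm _ _) (h.t_comm _ _)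
    exact hc.add_left hc'.symm

end YokonumaSystem

/-! #### From the extended affine Hecke algebra to the quotient `t_j = 1` of `Ŷ_{r,n}` -/

/-- With `t_j = 1` the idempotents `e_i` are `1`, so the `Ŷ` quadratic relation is the Hecke one.
The product `s_{n-1} ⋯ s_1` is invertible, which forces `X = (s_{n-1} ⋯ s_1)⁻¹ ρ`. The relations of
`X` with the `s_i` are recovered from the action of `ρ` and `ρ²` by conjugation. -/
theorem HeckeSystem.exists_yokonumaSystem {κ : K} {s : ZMod n → A} {ρ ρi : A}
    (h : HeckeSystem κ s ρ ρi) (hn : 2 ≤ n) (D : EigenData K r) :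
    ∃ X Xi : A, YokonumaSystem D κ (fun _ : ZMod n => (1 : A))
        (fun k => s ((k + 1 : ℕ) : ZMod n)) X Xi ∧
      descProd (fun k => s ((k + 1 : ℕ) : ZMod n)) (n - 1) * X = ρ := by
  have hsq (k : ℕ) : s ((k + 1 : ℕ) : ZMod n) ^ 2 =
      1 + κ • (D.eqProj (1 : A) 1 * s ((k + 1 : ℕ) : ZMod n)) := by
    rw [D.eqProj_one_one, one_mul, h.s_sq]
  have hunit (k : ℕ) : IsUnit (s ((k + 1 : ℕ) : ZMod n)) :=
    EigenData.isUnit_of_quadratic (κ := κ) (e := 1) (Commute.one_right _)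
      (by rw [one_mul, h.s_sq])
  have hbr : BraidRel (n - 1) (fun k => s ((k + 1 : ℕ) : ZMod n)) := by
    constructor
    · intro i j hj hij
      refine h.s_comm _ _ (fun h0 => ?_) (fun h0 => ?_)
      · have : ((i : ℕ) : ZMod n) = ((j + 1 : ℕ) : ZMod n) := by
          push_cast at h0 ⊢
          linear_combination h0
        rcases i with - | i
        · exact natCast_succ_ne_zero hj (by simpa using this.symm)
        · exact absurd (natCast_succ_injOn (by omega) (by omega) this) (by omega)
      · have : ((i + 1 + 1 : ℕ) : ZMod n) = ((j + 1 : ℕ) : ZMod n) := by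
          push_cast at h0 ⊢
          linear_combination h0
        exact absurd (natCast_succ_injOn (by omega) (by omega) this) (by omega)
    · intro i hi
      have := h.s_braid (by omega) ((i + 1 : ℕ) : ZMod n)
      rwa [← Nat.cast_succ] at this
  have hrho : ∀ i, i + 1 < n - 1 →
      SemiconjBy ρ (s ((i + 1 + 1 : ℕ) : ZMod n)) (s ((i + 1 : ℕ) : ZMod n)) := by
    intro i _
    have := h.rho_s ((i + 1 + 1 : ℕ) : ZMod n)
    rw [Nat.cast_succ (i + 1), add_sub_cancel_right] at this
    rwa [Nat.cast_succ (i + 1)]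
  have hrho2 : SemiconjBy (ρ * ρ) (s ((0 + 1 : ℕ) : ZMod n)) (s ((n - 2 + 1 : ℕ) : ZMod n)) := by
    have e : ((0 + 1 : ℕ) : ZMod n) - 1 - 1 = ((n - 2 + 1 : ℕ) : ZMod n) := by
      rw [show n - 2 + 1 = n - 1 by omega, Nat.cast_sub (by omega), ZMod.natCast_self]
      simp
    rw [← e]
    exact SemiconjBy.mul_left (h.rho_s _) (h.rho_s _)
  obtain ⟨p, hp⟩ := isUnit_descProd (g := fun k => s ((k + 1 : ℕ) : ZMod n)) (k := n - 1)
    fun i _ => hunit i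
  have hpX : descProd (fun k => s ((k + 1 : ℕ) : ZMod n)) (n - 1) * ((p⁻¹ : Aˣ) * ρ) = ρ := by
    rw [← hp, ← mul_assoc, Units.mul_inv, one_mul]
  have hX : ∀ i, 1 ≤ i → i < n - 1 →
      Commute (s ((i + 1 : ℕ) : ZMod n)) ((p⁻¹ : Aˣ) * ρ) := by
    intro i h1 hi
    refine hbr.commute_of_semiconjBy (fun i _ => hunit i) ?_ h1 hi
    rw [hpX]
    exact hrho
  refine ⟨(p⁻¹ : Aˣ) * ρ, ρi * p, ⟨hbr, fun _ _ => Commute.one_left _, ?_, fun _ => one_pow r,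
    fun k _ => hsq k, ?_, ?_, ?_, hX, fun _ => Commute.one_left _⟩, hpX⟩
  · intro i _ j
    rw [mul_one, one_mul]
  · rw [mul_assoc, ← mul_assoc ρ, h.rho_rhoInv, one_mul, Units.inv_mul]
  · rw [mul_assoc, ← mul_assoc (p : A), Units.mul_inv, one_mul, h.rhoInv_rho]
  · obtain ⟨k, rfl⟩ : ∃ k, n = k + 2 := ⟨n - 2, by omega⟩
    refine hbr.affine_of_semiconjBy (fun i _ => hunit i) hX ?_
    rw [show k + 1 = k + 2 - 1 from rfl, hpX]
    exact hrho2

end Systems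

/-! ### The eigenvalue data over the coefficient ring -/

/-- The powers `ζ, ζ², …, ζ^r` and the inverse of `A`, over `ℤ[1/r, ζ, Δ⁻¹]`. -/
def baseData {r : ℕ} (hr : 1 ≤ r) : EigenData (Base r) r where
  root c := zeta r ^ (c.val + 1)
  inv := vandInv r
  rInv := rInv r
  r_pos := hr
  root_pow c := by rw [← pow_mul, mul_comm, pow_mul, (isPrimitiveRoot_zeta hr).pow_eq_one, one_pow]
  inv_mul c d := by
    simp only [← pow_mul]
    exact sum_vandInv_mul_vand hr c d
  mul_inv i j := by
    simp only [← pow_mul]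
    exact sum_vand_mul_vandInv hr i j
  orthogonality := rInv_mul_sum_zeta_pow hr

def coeffData {r : ℕ} (hr : 1 ≤ r) : EigenData (Coeff r) r := (baseData hr).map LaurentPolynomial.C

/-! ### The correction and twist terms in spectral form -/

section Generic

variable {K A : Type*} [CommSemiring K] [Ring A] [Algebra K A] {r : ℕ} (D : EigenData K r)
  {δ δ₂ κ : K} {b : Fin r → Fin r → K}

/-- Applied with `δ = Δ⁻¹` and `b` the adjugate, this is `Δ⁻¹ F_c(x) = E_c(x)`; below, `δ₂` plays
the role of `Δ⁻²`, one factor for each projection. -/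
theorem EigenData.smul_aeval_sum_monomial (hb : ∀ c j, D.inv c j = δ * b c j) (x : A) (c : Fin r) :
    δ • Polynomial.aeval x (∑ j : Fin r, Polynomial.monomial j.val (b c j)) = D.proj x c := by
  simp only [map_sum, Polynomial.aeval_monomial, EigenData.proj, hb, Algebra.smul_def,
    Finset.mul_sum, map_mul, mul_assoc]

theorem EigenData.smul_sum_aeval_mul_aeval (hδ : δ₂ = δ * δ) (hb : ∀ c j, D.inv c j = δ * b c j)
    (x y : A) :
    (δ₂ * κ) • ∑ c : Fin r, ∑ d ∈ Finset.Ioi c,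
      Polynomial.aeval x (∑ j : Fin r, Polynomial.monomial j.val (b c j)) *
        Polynomial.aeval y (∑ j : Fin r, Polynomial.monomial j.val (b d j)) =
      κ • D.ltProj x y := by
  simp only [EigenData.ltProj, ← D.smul_aeval_sum_monomial hb, smul_mul_smul_comm, Finset.smul_sum,
    smul_smul, hδ, mul_comm κ]

/-- The weight `a c d` is the eigenvalue of `y - x` on `E_c(x) E_d(y)`, so the weighted sum is `y -
x` times the unweighted one. -/
theorem EigenData.smul_sum_smul_aeval_mul_aeval (hδ : δ₂ = δ * δ)
    (hb : ∀ c j, D.inv c j = δ * b c j) {a : Fin r → Fin r → K}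
    (ha : ∀ c d, a c d + D.root c = D.root d) {x y : A} (hx : x ^ r = 1) (hy : y ^ r = 1)
    (h : Commute x y) :
    δ₂ • ∑ c : Fin r, ∑ d ∈ Finset.Ioi c, (a c d * κ) •
      (Polynomial.aeval x (∑ j : Fin r, Polynomial.monomial j.val (b c j)) *
        Polynomial.aeval y (∑ j : Fin r, Polynomial.monomial j.val (b d j))) =
      (y - x) * (κ • D.ltProj x y) := by
  simp only [EigenData.ltProj, Finset.smul_sum, Finset.mul_sum, mul_smul_comm,
    D.sub_mul_proj_mul_proj hx hy h (ha _ _)]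
  simp only [← D.smul_aeval_sum_monomial hb, smul_mul_smul_comm, smul_smul, hδ]
  refine Finset.sum_congr rfl fun c _ => Finset.sum_congr rfl fun d _ => ?_
  congr 1
  ring

end Generic

section Coeff

variable {A : Type*} [Ring A] {r : ℕ} [Algebra (Coeff r) A]

theorem corr_eq (hr : 1 ≤ r) (x y : A) : corr r x y = qq r • (coeffData hr).ltProj x y :=
  (coeffData hr).smul_sum_aeval_mul_aeval (δ := LaurentPolynomial.C (deltaInv r))
    (by rw [← map_mul, ← pow_two]) (fun _ _ => map_mul LaurentPolynomial.C _ _) x y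

theorem corr_self (hr : 1 ≤ r) {x : A} (hx : x ^ r = 1) : corr r x x = 0 :=
  (corr_eq hr x x).trans ((coeffData hr).smul_ltProj_self (qq r) hx)

theorem twist_eq (hr : 1 ≤ r) {x y : A} (hx : x ^ r = 1) (hy : y ^ r = 1) (h : Commute x y) :
    twist r x y = (y - x) * (qq r • (coeffData hr).ltProj x y) :=
  (coeffData hr).smul_sum_smul_aeval_mul_aeval (δ := LaurentPolynomial.C (deltaInv r))
    (by rw [← map_mul, ← pow_two]) (fun _ _ => map_mul LaurentPolynomial.C _ _)
    (fun c d => (map_add LaurentPolynomial.C _ _).symm.trans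
      (congrArg LaurentPolynomial.C (sub_add_cancel _ _))) hx hy h

end Coeff

/-! ### The universal properties -/

section Lift

variable {A : Type*} [Ring A] {r n : ℕ} [Algebra (Coeff r) A]

theorem exists_algHom_C (hr : 1 ≤ r) {w s : ZMod n → A} {ρ ρi : A}
    (h : HeckeSystem (qq r) s ρ ρi) (h' : MixedSystem (coeffData hr) (qq r) w s ρ) :
    ∃ φ : C r n →ₐ[Coeff r] A, (∀ i, φ (C.of r n (.s i)) = s i) ∧ φ (C.of r n .rho) = ρ ∧
      φ (C.of r n .rhoInv) = ρi := by
  let f : CGen n → A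
    | .w j => w j
    | .s i => s i
    | .rho => ρ
    | .rhoInv => ρi
  have hf : ∀ ⦃x y : CFree r n⦄, CRel r n x y →
      FreeAlgebra.lift (Coeff r) f x = FreeAlgebra.lift (Coeff r) f y := by
    intro x y hxy
    induction hxy with
    | w_pow i => simpa [f] using h'.w_pow i
    | w_comm i j => simpa [f] using (h'.w_comm i j).eq
    | rho_w j => simpa [f] using h'.rho_w j
    | rho_s i => simpa [f] using h.rho_s i
    | s_comm i j h1 h2 => simpa [f] using h.s_comm i j h1 h2
    | s_braid hn i => simpa [f] using h.s_braid hn i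
    | s_sq i => simpa [f] using h.s_sq i
    | s_w i hi =>
      rw [map_mul, map_sub, map_twist, map_mul]
      simp only [FreeAlgebra.lift_ι_apply, f]
      rw [twist_eq hr (h'.w_pow _) (h'.w_pow _) (h'.w_comm _ _)]
      exact h'.s_w i hi
    | s_w_succ i hi =>
      rw [map_mul, map_add, map_twist, map_mul]
      simp only [FreeAlgebra.lift_ι_apply, f]
      rw [twist_eq hr (h'.w_pow _) (h'.w_pow _) (h'.w_comm _ _)]
      exact h'.s_w_succ i hi
    | s_w_comm i l hi h1 h2 => simpa [f] using h'.s_w_comm i l hi h1 h2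
    | rho_rhoInv => simpa [f] using h.rho_rhoInv
    | rhoInv_rho => simpa [f] using h.rhoInv_rho
  refine ⟨RingQuot.liftAlgHom (Coeff r) ⟨FreeAlgebra.lift (Coeff r) f, hf⟩, fun i => ?_, ?_, ?_⟩ <;>
    rw [C.of, RingQuot.liftAlgHom_mkAlgHom_apply, FreeAlgebra.lift_ι_apply]

theorem exists_algHom_Y (hr : 1 ≤ r) {t : ZMod n → A} {g : ℕ → A} {X Xi : A}
    (h : YokonumaSystem (coeffData hr) (qq r) t g X Xi) :
    ∃ φ : Y r n →ₐ[Coeff r] A, (∀ j, φ (Y.of r n (.t j)) = t j) ∧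
      (∀ i, φ (Y.of r n (.g i)) = g i.val) ∧ φ (Y.of r n .X) = X := by
  let f : YGen n → A
    | .t j => t j
    | .g i => g i.val
    | .X => X
    | .Xinv => Xi
  have hf : ∀ ⦃x y : YFree r n⦄, YRel r n x y →
      FreeAlgebra.lift (Coeff r) f x = FreeAlgebra.lift (Coeff r) f y := by
    intro x y hxy
    induction hxy with
    | g_comm i j hij =>
      rcases hij with hij | hij
      · simpa [f] using (h.braidRel.comm _ _ j.isLt hij).eq
      · simpa [f] using (h.braidRel.comm _ _ i.isLt hij).eq.symm
    | g_braid i j hij =>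
      have := h.braidRel.braid i.val (by have := j.isLt; omega)
      rw [← hij] at this
      simpa [f] using this
    | t_comm i j => simpa [f] using (h.t_comm i j).eq
    | g_t i j => simpa [f, pos] using h.g_t i.val i.isLt j
    | t_pow i => simpa [f] using h.t_pow i
    | g_sq i =>
      rw [map_pow, map_add, map_smul, map_mul, map_idem, map_one]
      simp only [FreeAlgebra.lift_ι_apply, f]
      exact h.g_sq i.val i.isLt
    | X_Xinv => simpa [f] using h.X_Xinv
    | Xinv_X => simpa [f] using h.Xinv_X
    | g_X_one i hi => simpa [f, hi] using h.g_X_zero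
    | g_X i hi => simpa [f] using (h.g_X i.val hi i.isLt).eq
    | t_X j => simpa [f] using (h.t_X j).eq
  refine ⟨RingQuot.liftAlgHom (Coeff r) ⟨FreeAlgebra.lift (Coeff r) f, hf⟩, fun i => ?_,
    fun i => ?_, ?_⟩ <;>
    rw [Y.of, RingQuot.liftAlgHom_mkAlgHom_apply, FreeAlgebra.lift_ι_apply]

theorem exists_algHom_H {s : ZMod n → A} {ρ ρi : A} (h : HeckeSystem (qq r) s ρ ρi) :
    ∃ φ : H r n →ₐ[Coeff r] A, (∀ i, φ (H.of r n (.s i)) = s i) ∧ φ (H.of r n .rho) = ρ ∧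
      φ (H.of r n .rhoInv) = ρi := by
  let f : HGen n → A
    | .s i => s i
    | .rho => ρ
    | .rhoInv => ρi
  have hf : ∀ ⦃x y : HFree r n⦄, HRel r n x y →
      FreeAlgebra.lift (Coeff r) f x = FreeAlgebra.lift (Coeff r) f y := by
    intro x y hxy
    induction hxy with
    | rho_s i => simpa [f] using h.rho_s i
    | s_comm i j h1 h2 => simpa [f] using h.s_comm i j h1 h2
    | s_braid hn i => simpa [f] using h.s_braid hn i
    | s_sq i => simpa [f] using h.s_sq i
    | rho_rhoInv => simpa [f] using h.rho_rhoInv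
    | rhoInv_rho => simpa [f] using h.rhoInv_rho
  refine ⟨RingQuot.liftAlgHom (Coeff r) ⟨FreeAlgebra.lift (Coeff r) f, hf⟩, fun i => ?_, ?_, ?_⟩ <;>
    rw [H.of, RingQuot.liftAlgHom_mkAlgHom_apply, FreeAlgebra.lift_ι_apply]

end Lift

/-! ### The presented algebras -/

/-- Negation is the scalar action of `-1`, so the underlying semiring remains the one that carries
the algebra structure. -/
instance (r n : ℕ) : Ring (Y r n) := Algebra.semiringToRing (Coeff r)

instance (r n : ℕ) : Ring (C r n) := Algebra.semiringToRing (Coeff r)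

instance (r n : ℕ) : Ring (H r n) := Algebra.semiringToRing (Coeff r)

theorem heckeSystem_H (r n : ℕ) : HeckeSystem (K := Coeff r) (qq r)
    (fun i : ZMod n => H.of r n (.s i)) (H.of r n .rho) (H.of r n .rhoInv) where
  rho_s i := by
    simpa [H.of] using RingQuot.mkAlgHom_rel (Coeff r) (HRel.rho_s (r := r) i)
  s_comm i j h1 h2 := by
    simpa [H.of] using RingQuot.mkAlgHom_rel (Coeff r) (HRel.s_comm (r := r) i j h1 h2)
  s_braid hn i := by
    simpa [H.of] using RingQuot.mkAlgHom_rel (Coeff r) (HRel.s_braid (r := r) hn i)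
  s_sq i := by
    simpa [H.of] using RingQuot.mkAlgHom_rel (Coeff r) (HRel.s_sq (r := r) i)
  rho_rhoInv := by
    simpa [H.of] using RingQuot.mkAlgHom_rel (Coeff r) (HRel.rho_rhoInv (r := r) (n := n))
  rhoInv_rho := by
    simpa [H.of] using RingQuot.mkAlgHom_rel (Coeff r) (HRel.rhoInv_rho (r := r) (n := n))

theorem heckeSystem_C (r n : ℕ) : HeckeSystem (K := Coeff r) (qq r)
    (fun i : ZMod n => C.of r n (.s i)) (C.of r n .rho) (C.of r n .rhoInv) where
  rho_s i := by
    simpa [C.of] using RingQuot.mkAlgHom_rel (Coeff r) (CRel.rho_s (r := r) i)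
  s_comm i j h1 h2 := by
    simpa [C.of] using RingQuot.mkAlgHom_rel (Coeff r) (CRel.s_comm (r := r) i j h1 h2)
  s_braid hn i := by
    simpa [C.of] using RingQuot.mkAlgHom_rel (Coeff r) (CRel.s_braid (r := r) hn i)
  s_sq i := by
    simpa [C.of] using RingQuot.mkAlgHom_rel (Coeff r) (CRel.s_sq (r := r) i)
  rho_rhoInv := by
    simpa [C.of] using RingQuot.mkAlgHom_rel (Coeff r) (CRel.rho_rhoInv (r := r) (n := n))
  rhoInv_rho := by
    simpa [C.of] using RingQuot.mkAlgHom_rel (Coeff r) (CRel.rhoInv_rho (r := r) (n := n))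

/-- The generator `g_{k+1}` of `Ŷ_{r,n}`, and `1` for `k ≥ n - 1`. -/
def gNat (r n k : ℕ) : Y r n := if h : k < n - 1 then Y.of r n (.g ⟨k, h⟩) else 1

theorem gNat_of_lt (r : ℕ) {n k : ℕ} (h : k < n - 1) : gNat r n k = Y.of r n (.g ⟨k, h⟩) :=
  dif_pos h

theorem gProd_eq (r n : ℕ) : gProd r n = descProd (gNat r n) (n - 1) := by
  rw [← descProd_eq_prod, gProd]
  congr 3
  funext i
  exact (gNat_of_lt r i.isLt).symm

theorem yokonumaSystem_Y {r n : ℕ} (hr : 1 ≤ r) (hn : 2 ≤ n) :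
    YokonumaSystem (coeffData hr) (qq r) (fun j : ZMod n => Y.of r n (.t j)) (gNat r n)
      (Y.of r n .X) (Y.of r n .Xinv) where
  braidRel := by
    constructor
    · intro i j hj hij
      rw [gNat_of_lt r hj, gNat_of_lt r (show i < n - 1 by omega)]
      simpa [Y.of, commute_iff_eq] using RingQuot.mkAlgHom_rel (Coeff r)
        (YRel.g_comm (r := r) ⟨i, show i < n - 1 by omega⟩ ⟨j, hj⟩ (Or.inl hij))
    · intro i hi
      rw [gNat_of_lt r hi, gNat_of_lt r (show i < n - 1 by omega)]
      simpa [Y.of] using RingQuot.mkAlgHom_rel (Coeff r)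
        (YRel.g_braid (r := r) ⟨i, show i < n - 1 by omega⟩ ⟨i + 1, hi⟩ rfl)
  t_comm i j := by
    simpa [Y.of, commute_iff_eq] using RingQuot.mkAlgHom_rel (Coeff r) (YRel.t_comm (r := r) i j)
  g_t i hi j := by
    rw [gNat_of_lt r hi]
    simpa [Y.of, pos] using RingQuot.mkAlgHom_rel (Coeff r) (YRel.g_t (r := r) ⟨i, hi⟩ j)
  t_pow i := by
    simpa [Y.of] using RingQuot.mkAlgHom_rel (Coeff r) (YRel.t_pow (r := r) i)
  g_sq i hi := by
    rw [gNat_of_lt r hi]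
    have := RingQuot.mkAlgHom_rel (Coeff r) (YRel.g_sq (r := r) (n := n) ⟨i, hi⟩)
    rw [map_pow, map_add, map_smul, map_mul, map_idem, map_one] at this
    exact this
  X_Xinv := by
    simpa [Y.of] using RingQuot.mkAlgHom_rel (Coeff r) (YRel.X_Xinv (r := r) (n := n))
  Xinv_X := by
    simpa [Y.of] using RingQuot.mkAlgHom_rel (Coeff r) (YRel.Xinv_X (r := r) (n := n))
  g_X_zero := by
    rw [gNat_of_lt r (show 0 < n - 1 by omega)]
    simpa [Y.of] using RingQuot.mkAlgHom_rel (Coeff r)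
      (YRel.g_X_one (r := r) ⟨0, show 0 < n - 1 by omega⟩ rfl)
  g_X i h1 hi := by
    rw [gNat_of_lt r hi]
    simpa [Y.of, commute_iff_eq] using
      RingQuot.mkAlgHom_rel (Coeff r) (YRel.g_X (r := r) ⟨i, hi⟩ h1)
  t_X j := by
    simpa [Y.of, commute_iff_eq] using RingQuot.mkAlgHom_rel (Coeff r) (YRel.t_X (r := r) j)

/-- `Ĉ^aff_{r,n} → Ŷ_{r,n}`. -/
theorem exists_C_to_Y {r n : ℕ} (hr : 1 ≤ r) (hn : 2 ≤ n) :
    ∃ φ : C r n →ₐ[Coeff r] Y r n,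
      (∀ i : Fin (n - 1), φ (C.of r n (.s (pos i))) = Y.of r n (.g i) +
        corr r (Y.of r n (.t (pos i))) (Y.of r n (.t (pos i + 1)))) ∧
      φ (C.of r n .rho) = gProd r n * Y.of r n .X := by
  obtain ⟨s, ρi, h1, h2, h3⟩ := (yokonumaSystem_Y hr hn).exists_heckeSystem hn
  obtain ⟨φ, hs, hρ, -⟩ := exists_algHom_C hr h1 h2
  refine ⟨φ, fun i => ?_, ?_⟩
  · rw [hs, pos, h3 i.val i.isLt, YokonumaSystem.hecke, gNat_of_lt r i.isLt, corr_eq hr,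
      Nat.cast_succ (i.val + 1)]
  · rw [hρ, gProd_eq]

/-- `Ŷ_{r,n} → Ĥ^aff_n`, sending every `t_j` to `1`. -/
theorem exists_Y_to_H {r n : ℕ} (hr : 1 ≤ r) (hn : 2 ≤ n) :
    ∃ π : Y r n →ₐ[Coeff r] H r n, (∀ j, π (Y.of r n (.t j)) = 1) ∧
      (∀ i, π (Y.of r n (.g i)) = H.of r n (.s (pos i))) ∧
      π (gProd r n * Y.of r n .X) = H.of r n .rho := by
  obtain ⟨X, Xi, h, hρ⟩ := (heckeSystem_H r n).exists_yokonumaSystem hn (coeffData hr)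
  obtain ⟨π, ht, hg, hX⟩ := exists_algHom_Y hr h
  refine ⟨π, ht, hg, ?_⟩
  rw [map_mul, hX, ← hρ, gProd_eq]
  congr 1
  refine (map_descProd (π : Y r n →* H r n) _ _).trans (descProd_congr fun i hi => ?_)
  rw [gNat_of_lt r hi]
  exact hg _

/-- Hence `T_{s_0}` is redundant as a generator, and a homomorphism is determined without its value
there. -/
theorem H_of_s_zero {r n : ℕ} :
    H.of r n (.s 0) = H.of r n .rho * H.of r n (.s 1) * H.of r n .rhoInv := by
  have h := heckeSystem_H r n
  have h1 := h.rho_s 1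
  rw [sub_self] at h1
  rw [h1, mul_assoc, h.rho_rhoInv, mul_one]

/-- An endomorphism that fixes `T_ρ` and `T_{s_1}, …, T_{s_{n-1}}` is the identity. -/
theorem algHom_H_eq_id {r n : ℕ} (hn : 2 ≤ n) {θ : H r n →ₐ[Coeff r] H r n}
    (hs : ∀ i : Fin (n - 1), θ (H.of r n (.s (pos i))) = H.of r n (.s (pos i)))
    (hρ : θ (H.of r n .rho) = H.of r n .rho) (x : H r n) : θ x = x := by
  have h := heckeSystem_H r n
  have hρi : θ (H.of r n .rhoInv) = H.of r n .rhoInv := by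
    have h1 : θ (H.of r n .rhoInv) * H.of r n .rho = 1 := by
      rw [← hρ, ← map_mul, h.rhoInv_rho, map_one]
    rw [← mul_one (θ _), ← h.rho_rhoInv, ← mul_assoc, h1, one_mul]
  have hs' : ∀ i : ZMod n, θ (H.of r n (.s i)) = H.of r n (.s i) := by
    have hne (i : ZMod n) (hi : i ≠ 0) : θ (H.of r n (.s i)) = H.of r n (.s i) := by
      obtain ⟨k, hk, rfl⟩ := exists_eq_natCast_succ_of_ne_zero hn hi
      exact hs ⟨k, hk⟩
    intro i
    by_cases hi : i = 0
    · have : Fact (1 < n) := ⟨hn⟩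
      rw [hi, H_of_s_zero, map_mul, map_mul, hρ, hρi, hne 1 one_ne_zero]
    · exact hne i hi
  have : θ = AlgHom.id (Coeff r) (H r n) := by
    apply RingQuot.ringQuot_ext'
    apply FreeAlgebra.hom_ext
    funext y
    cases y with
    | s i => exact hs' i
    | rho => exact hρ
    | rhoInv => exact hρi
  rw [this]
  rfl

/-- `Ĥ^aff_n → Ĉ^aff_{r,n}`, with image the subalgebra `heckeSub`. -/
theorem exists_H_to_C (r n : ℕ) :
    ∃ j : H r n →ₐ[Coeff r] C r n, (∀ i, j (H.of r n (.s i)) = C.of r n (.s i)) ∧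
      j (H.of r n .rho) = C.of r n .rho ∧ j.range = heckeSub r n := by
  obtain ⟨j, hs, hρ, hρi⟩ := exists_algHom_H (heckeSystem_C r n)
  refine ⟨j, hs, hρ, le_antisymm ?_ ?_⟩
  · rintro _ ⟨x, rfl⟩
    obtain ⟨x, rfl⟩ := RingQuot.mkAlgHom_surjective (Coeff r) (HRel r n) x
    change j (RingQuot.mkAlgHom (Coeff r) (HRel r n) x) ∈ heckeSub r n
    induction x using FreeAlgebra.induction with
    | grade0 a =>
      rw [AlgHom.commutes, AlgHom.commutes]
      exact Subalgebra.algebraMap_mem _ a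
    | grade1 y =>
      cases y with
      | s i =>
        have : j (H.of r n (.s i)) ∈ heckeSub r n := by
          rw [hs]; exact Algebra.subset_adjoin (Or.inl ⟨i, rfl⟩)
        exact this
      | rho =>
        have : j (H.of r n .rho) ∈ heckeSub r n := by
          rw [hρ]; exact Algebra.subset_adjoin (Or.inr (Or.inl rfl))
        exact this
      | rhoInv =>
        have : j (H.of r n .rhoInv) ∈ heckeSub r n := by
          rw [hρi]; exact Algebra.subset_adjoin (Or.inr (Or.inr rfl))
        exact this
    | mul a b ha hb => rw [map_mul, map_mul]; exact Subalgebra.mul_mem _ ha hb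
    | add a b ha hb => rw [map_add, map_add]; exact Subalgebra.add_mem _ ha hb
  · refine Algebra.adjoin_le ?_
    rintro _ (⟨i, rfl⟩ | rfl | rfl)
    · exact ⟨_, hs i⟩
    · exact ⟨_, hρ⟩
    · exact ⟨_, hρi⟩

end

end AffYH

/-- The subalgebra of `Ĉ^aff_{r,n}` generated by the `h_{s_i}` and `h_ρ^{±1}` is (canonically) the
extended affine Hecke algebra of type `A`, and it embeds in `Ŷ_{r,n}`. The values listed at the end
determine the embedding, because `h_{s_0} = h_ρ h_{s_1} h_ρ⁻¹`. -/
theorem corollary3p11 (r n : ℕ) (hr : 1 ≤ r) (hn : 2 ≤ n) :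
    ∃ (κ : AffYH.H r n ≃ₐ[AffYH.Coeff r] AffYH.heckeSub r n)
      (ι : AffYH.heckeSub r n →ₐ[AffYH.Coeff r] AffYH.Y r n),
      (∀ i : ZMod n, (κ (AffYH.H.of r n (.s i)) : AffYH.C r n) = AffYH.C.of r n (.s i)) ∧
      (κ (AffYH.H.of r n .rho) : AffYH.C r n) = AffYH.C.of r n .rho ∧
      Function.Injective ι ∧
      (∀ (x : AffYH.heckeSub r n) (i : Fin (n - 1)),
        (x : AffYH.C r n) = AffYH.C.of r n (.s (AffYH.pos i)) →
          ι x = AffYH.Y.of r n (.g i) +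
            AffYH.corr r (AffYH.Y.of r n (.t (AffYH.pos i)))
              (AffYH.Y.of r n (.t (AffYH.pos i + 1)))) ∧
      (∀ x : AffYH.heckeSub r n, (x : AffYH.C r n) = AffYH.C.of r n .rho →
        ι x = AffYH.gProd r n * AffYH.Y.of r n .X) := by
  obtain ⟨φ, hφs, hφρ⟩ := AffYH.exists_C_to_Y hr hn
  obtain ⟨π, hπt, hπg, hπρ⟩ := AffYH.exists_Y_to_H hr hn
  obtain ⟨j, hjs, hjρ, hj⟩ := AffYH.exists_H_to_C r n
  have hid : ∀ x, π (φ (j x)) = x := by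
    refine AffYH.algHom_H_eq_id hn (θ := π.comp (φ.comp j)) (fun i => ?_) ?_
    · change π (φ (j _)) = _
      -- The correction term maps to `corr r 1 1 = 0`.
      rw [hjs, hφs, map_add, AffYH.map_corr, hπt, hπt, hπg,
        AffYH.corr_self hr (one_pow r), add_zero]
    · change π (φ (j _)) = _
      rw [hjρ, hφρ, hπρ]
  have hinj : Function.Injective j := fun x y hxy => by rw [← hid x, ← hid y, hxy]
  let κ : AffYH.H r n ≃ₐ[AffYH.Coeff r] AffYH.heckeSub r n :=
    (AlgEquiv.ofInjective j hinj).trans (Subalgebra.equivOfEq _ _ hj)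
  have hκ : ∀ x, (κ x : AffYH.C r n) = j x := fun x => rfl
  refine ⟨κ, φ.comp (AffYH.heckeSub r n).val, fun i => (hκ _).trans (hjs i), (hκ _).trans hjρ,
    ?_, ?_, ?_⟩
  · intro x y hxy
    -- Through `κ`, the map `ι` becomes `φ ∘ j`, which has the left inverse `π`.
    obtain ⟨x, rfl⟩ := κ.surjective x
    obtain ⟨y, rfl⟩ := κ.surjective y
    have hxy' : φ (j x) = φ (j y) := hxy
    rw [← hid x, ← hid y, hxy']
  · intro x i hx
    rw [AlgHom.comp_apply, Subalgebra.val_apply, hx, hφs]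
  · intro x hx
    rw [AlgHom.comp_apply, Subalgebra.val_apply, hx, hφρ]
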